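/- Let $X_1,X_2,\dots$ be i.i.d. random variables with $\mathbb P(X_i=1)=\mathbb P(X_i=-1)=\frac12$. For a sequence ${\bf a}=(a_1,a_2,\dots)$ of non-negative numbers, the ${\bf a}$-walk is $S(n)=a_1X_1+\dots+a_nX_n$, $S(0)=0$; it is a.s. recurrent if almost surely $S(n)=0$ for infinitely many $n$. Say that a sequence $L_1,L_2,\dots$ of non-negative integers satisfies the growth condition if there are $\varepsilon>0$, $r>0$ and $k_0$ such that $$ L_k\ge (2+\varepsilon)\ln k\,\bigl(L_1+L_2+\dots+L_{k'}\bigr),\qquad L_k\ge 2r\,\bigl(L_{k'+1}+L_{k'+2}+\dots+L_{k-1}\bigr),\qquad L_k\ge k^4 $$ for all integers $k\ge 2$ and $k'\ge 1$ with $k,k'\ge k_0$ and $k-k'\ge \frac{k}{\ln k}-2$. 1. Let $L_k\ge 1$ $(k=1,2,\dots)$ be integers satisfying the growth condition, and let ${\bf a}=(B_1,B_2,B_3,\dots)$, where $B_k$ is a block of exactly $L_k$ consecutive entries equal to $k$. Then the ${\bf a}$-walk is a.s. recurrent. 2. Let $\gamma>1$, $\beta\in(0,1]$ and $a_i=\lfloor(\log_\gamma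 i)^\beta\rfloor$, $i=1,2,\dots$. Then the numbers $L_k=\#\{i\ge 1: a_i=k\}$, $k\ge 1$, satisfy the growth condition, and the ${\bf a}$-walk is a.s. recurrent. 3. Let $\gamma>1$ and $a_i=\lceil\log_\gamma i\rceil$, $i=1,2,\dots$. Then the numbers $L_k=\#\{i\ge 1: a_i=k\}$, $k\ge 1$, satisfy the growth condition, and the ${\bf a}$-walk is a.s. recurrent. -/

import Mathlib

open MeasureTheory ProbabilityTheory Filter

/-- `X 1, X 2, …` are i.i.d. random variables on `(Ω, μ)` with
`P(X = 1) = P(X = -1) = 1/2`.  The value `X 0` plays no role. -/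
structure IsRademacherSeq {Ω : Type*} [MeasurableSpace Ω] (μ : Measure Ω)
    (X : ℕ → Ω → ℝ) : Prop where
  measurable : ∀ i, 1 ≤ i → Measurable (X i)
  indep : iIndepFun (fun i : ℕ => X (i + 1)) μ
  prob_one : ∀ i, 1 ≤ i → μ {ω | X i ω = 1} = 1 / 2
  prob_neg_one : ∀ i, 1 ≤ i → μ {ω | X i ω = -1} = 1 / 2

/-- The `a`-walk `S(n) = a₁ X₁ + ⋯ + aₙ Xₙ`, with `S(0) = 0`. -/
noncomputable def aWalk {Ω : Type*} (a : ℕ → ℝ) (X : ℕ → Ω → ℝ) (n : ℕ) (ω : Ω) : ℝ :=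
  ∑ i ∈ Finset.Icc 1 n, a i * X i ω

/-- The `a`-walk is a.s. recurrent: almost surely `S(n) = 0` for infinitely many `n`. -/
def AWalkRecurrent {Ω : Type*} [MeasurableSpace Ω] (μ : Measure Ω)
    (a : ℕ → ℝ) (X : ℕ → Ω → ℝ) : Prop :=
  ∀ᵐ ω ∂μ, ∃ᶠ n in atTop, aWalk a X n ω = 0

/-- The sequence made of `L 1` ones, then `L 2` twos, then `L 3` threes, and so on
(indexed from `1`): its `i`-th term is the least `k` with `i ≤ L₁ + ⋯ + L_k`.
The values `L 0` and `blockSeq L 0` play no role. -/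
noncomputable def blockSeq (L : ℕ → ℕ) (i : ℕ) : ℕ :=
  sInf {k : ℕ | i ≤ ∑ j ∈ Finset.Icc 1 k, L j}

/-- The growth conditions on block lengths `L₁, L₂, …`.  The lower bounds on the ratios
`L_k / (L₁ + ⋯ + L_{k'})` and `L_k / (L_{k'+1} + ⋯ + L_{k-1})` are cleared of denominators,
so that a bound with an empty sum in the denominator holds trivially.
`2 ≤ k` only ensures that `k / log k` makes sense. -/
def BlockGrowth (L : ℕ → ℕ) : Prop :=
  ∃ ε : ℝ, 0 < ε ∧ ∃ r : ℝ, 0 < r ∧ ∃ k₀ : ℕ, ∀ k k' : ℕ,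
    2 ≤ k → 1 ≤ k' → k₀ ≤ k → k₀ ≤ k' →
    (k : ℝ) - (k' : ℝ) ≥ (k : ℝ) / Real.log k - 2 →
      (L k : ℝ) ≥ (2 + ε) * Real.log k * ∑ j ∈ Finset.Icc 1 k', (L j : ℝ) ∧
      (L k : ℝ) ≥ 2 * r * ∑ j ∈ Finset.Ioo k' k, (L j : ℝ) ∧
      (L k : ℝ) ≥ (k : ℝ) ^ 4

/-- The number of indices `i ≥ 1` at which the sequence `a` takes the value `k`. -/
noncomputable def blockLength (a : ℕ → ℕ) (k : ℕ) : ℕ :=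
  Set.ncard {i : ℕ | 1 ≤ i ∧ a i = k}

/-- `a_i = ⌊(log_γ i)^β⌋`, `i ≥ 1`. -/
noncomputable def floorLogSeq (γ β : ℝ) (i : ℕ) : ℕ :=
  ⌊(Real.logb γ i) ^ β⌋₊

/-- `a_i = ⌈log_γ i⌉`, `i ≥ 1`. -/
noncomputable def ceilLogSeq (γ : ℝ) (i : ℕ) : ℕ :=
  ⌈Real.logb γ i⌉₊

/-! Let `N k` be the last index `i` with `a i ≤ k`, so that the steps of size `k` fill a block of
length `L k = N k - N (k - 1)`. For odd `k`, look at blocks `k - 1` and `k` together. Steps of size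
`k - 1` are `±1` modulo `k`, and because `k` is odd a local binomial estimate shows that block `k -
1` brings the walk into `kℤ` with probability at least of order `1 / k`. From there, steps `±k`
cannot jump over `0`, and with probability bounded below block `k` carries the walk across it. So,
given the past, block `k` contains a zero with probability at least `c / k`, provided the walk was
at distance at most `C k √(L k)` before block `k - 1` (`exists_hit_lower`).

If `N (k - 1) ≤ M * L k`, Chebyshev bounds the probability that this proviso fails by `M / C ^ 2`.
The sum of `c / k` over odd `k` diverges, so outside an event of probability at most `M / C ^ 2` the
conditional probabilities have infinite sum (`measure_not_tendsto_weighted_sum_le`), and Lévy's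
conditional Borel–Cantelli lemma yields infinitely many zeros. Letting `C → ∞` proves recurrence
(`awalkRecurrent_of_blocks`).

The growth condition supplies the ratio `M` and blocks long enough to mix modulo `k`
(`awalkRecurrent_of_blockGrowth`). The logarithmic sequences satisfy it because their `N k` grows at
least geometrically (`blockGrowth_of_geometric`). -/

/-! ### Binomial coefficients near the centre -/

lemma four_pow_le_mul_choose_half_sq (n : ℕ) (hn : 1 ≤ n) :
    4 ^ n ≤ 4 * n * (n.choose (n / 2)) ^ 2 := by
  -- The induction rests on `4q(q+1) ≤ (2q+1)^2` with `q = p + 1`; the shift excludes `p = 0`, where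
  -- the bound fails.
  have central : ∀ p : ℕ, 16 ^ (p + 1) ≤ 4 * (p + 1) * (Nat.centralBinom (p + 1)) ^ 2 := by
    intro p
    induction p with
    | zero => simp [Nat.centralBinom]
    | succ p ih =>
      have h := Nat.succ_mul_centralBinom_succ (p + 1)
      have h2 : (p + 2) * (16 ^ (p + 2)) ≤
          (p + 2) * (4 * (p + 2) * (Nat.centralBinom (p + 2)) ^ 2) := by
        calc (p + 2) * 16 ^ (p + 2) = 16 * (p + 2) * 16 ^ (p + 1) := by ring
          _ ≤ 16 * (p + 2) * (4 * (p + 1) * (Nat.centralBinom (p + 1)) ^ 2) := by gcongr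
          _ = 16 * (4 * (p + 1) * (p + 2)) * (Nat.centralBinom (p + 1)) ^ 2 := by ring
          _ ≤ 16 * ((2 * (p + 1) + 1) ^ 2) * (Nat.centralBinom (p + 1)) ^ 2 := by
            gcongr; nlinarith
          _ = 4 * (2 * (2 * (p + 1) + 1) * Nat.centralBinom (p + 1)) ^ 2 := by ring
          _ = 4 * ((p + 1 + 1) * Nat.centralBinom (p + 1 + 1)) ^ 2 := by rw [h]
          _ = _ := by ring
      exact Nat.le_of_mul_le_mul_left h2 (by positivity)
  rcases Nat.even_or_odd' n with ⟨p, rfl | rfl⟩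
  · obtain ⟨q, rfl⟩ : ∃ q, p = q + 1 := ⟨p - 1, by omega⟩
    have h := central q
    rw [Nat.centralBinom] at h
    rw [Nat.mul_div_cancel_left _ (by norm_num), pow_mul]
    norm_num
    nlinarith
  · have h := central p
    have h3 : Nat.centralBinom (p + 1) = 2 * (2 * p + 1).choose p := by
      rw [Nat.centralBinom, show 2 * (p + 1) = (2 * p + 1) + 1 by ring, Nat.choose_succ_succ,
        Nat.choose_symm_half]; ring
    rw [h3] at h
    have h4 : (2 * p + 1) / 2 = p := by omega
    rw [h4]
    have h5 : 4 ^ (2 * p + 1) * 4 = 16 ^ (p + 1) := by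
      rw [← pow_succ, show (16 : ℕ) = 4 ^ 2 by norm_num, ← pow_mul]; congr 1
    nlinarith [Nat.zero_le (p * (2 * p + 1).choose p ^ 2)]

lemma choose_half_lower (n : ℕ) (hn : 1 ≤ n) :
    1 / (2 * √n) ≤ (n.choose (n / 2) : ℝ) / 2 ^ n := by
  have hn' : (0 : ℝ) < n := by exact_mod_cast hn
  have h : ((4 : ℝ)) ^ n ≤ 4 * n * (n.choose (n / 2) : ℝ) ^ 2 := by
    exact_mod_cast four_pow_le_mul_choose_half_sq n hn
  rw [div_le_div_iff₀ (by positivity) (by positivity), one_mul]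
  refine (sq_le_sq₀ (by positivity) (by positivity)).1 ?_
  calc ((2 : ℝ) ^ n) ^ 2 = 4 ^ n := by rw [← pow_mul, mul_comm, pow_mul]; norm_num
    _ ≤ _ := h
    _ = _ := by rw [mul_pow, mul_pow, Real.sq_sqrt hn'.le]; ring

/-- Each step away from the centre multiplies the coefficient by `h / (n - h + 1)`, which is at
least `1 - (4D+4)/n` within distance `D`. The second alternative sets aside a negative base, whose
powers give no bound. -/
lemma choose_half_sub_lower (n D d : ℕ) (hD : D ≤ n / 2) (hd : d ≤ D) :
    (n.choose (n / 2) : ℝ) * (1 - (4 * D + 4) / n) ^ d ≤ n.choose (n / 2 - d) ∨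
      (1 - (4 * D + 4) / (n : ℝ)) < 0 := by
  by_cases hx : (1 - (4 * D + 4) / (n : ℝ)) < 0
  · exact Or.inr hx
  left
  push Not at hx
  induction d with
  | zero => simp
  | succ d ih =>
    have ih := ih (by omega)
    have hr := Nat.choose_succ_right_eq n (n / 2 - (d + 1))
    rw [show n / 2 - (d + 1) + 1 = n / 2 - d by omega] at hr
    have hr' : (n.choose (n / 2 - d) : ℝ) * ((n / 2 - d : ℕ) : ℝ) =
        n.choose (n / 2 - (d + 1)) * ((n - (n / 2 - (d + 1)) : ℕ) : ℝ) := by exact_mod_cast hr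
    have hn : (0 : ℝ) < n := by
      have : 0 < n := by omega
      exact_mod_cast this
    have hq : (0 : ℝ) < ((n - (n / 2 - (d + 1)) : ℕ) : ℝ) := by
      have : 0 < (n - (n / 2 - (d + 1))) := by omega
      exact_mod_cast this
    have hkey : (1 - (4 * D + 4) / (n : ℝ)) * ((n - (n / 2 - (d + 1)) : ℕ) : ℝ) ≤
        ((n / 2 - d : ℕ) : ℝ) := by
      have e1 : n - (n / 2 - (d + 1)) ≤ (n / 2 - d) + (2 * D + 2) := by omega
      have e2 : n ≤ 2 * (n - (n / 2 - (d + 1))) := by omega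
      have e1' : ((n - (n / 2 - (d + 1)) : ℕ) : ℝ) ≤ ((n / 2 - d : ℕ) : ℝ) + (2 * D + 2) := by
        exact_mod_cast e1
      have e2' : (n : ℝ) ≤ 2 * ((n - (n / 2 - (d + 1)) : ℕ) : ℝ) := by exact_mod_cast e2
      have e3 : (2 * D + 2 : ℝ) ≤ (4 * D + 4) / n * ((n - (n / 2 - (d + 1)) : ℕ) : ℝ) := by
        rw [div_mul_eq_mul_div, le_div_iff₀ hn]
        nlinarith [Nat.cast_nonneg (α := ℝ) D]
      nlinarith
    rw [pow_succ, ← mul_assoc]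
    refine le_of_mul_le_mul_right ?_ hq
    rw [← hr', mul_assoc]
    exact mul_le_mul ih hkey (by positivity) (by positivity)

/-- Local lower bound for the symmetric binomial law at distance `O(√n)` below the centre. -/
lemma exists_choose_lower (A : ℝ) (hA : 0 < A) : ∃ c : ℝ, 0 < c ∧ ∃ n₀ : ℕ, 1 ≤ n₀ ∧
    ∀ n d : ℕ, n₀ ≤ n → (d : ℝ) ≤ A * √n →
      d ≤ n / 2 ∧ c / √n ≤ (n.choose (n / 2 - d) : ℝ) / 2 ^ n := by
  -- The threshold on `n` forces `√n ≥ 8(A+2)`, hence `8d ≤ n` and `x ≤ 1/2` below; then `(1-x)^d ≥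
  -- exp(-2xd)` with `xd` bounded in terms of `A`.
  refine ⟨Real.exp (-(2 * (4 * (A + 1) * (A + 2)))) / 2, by positivity,
    ⌈(8 * (A + 2)) ^ 2⌉₊ + 1, by omega, fun n d hn hd => ?_⟩
  have hn1 : (8 * (A + 2)) ^ 2 ≤ (n : ℝ) :=
    (Nat.le_ceil _).trans (by exact_mod_cast (by omega : ⌈(8 * (A + 2)) ^ 2⌉₊ ≤ n))
  have hn0 : (0 : ℝ) < n := lt_of_lt_of_le (by positivity) hn1
  have hs : 8 * (A + 2) ≤ √n := Real.le_sqrt_of_sq_le hn1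
  have hs2 : √(n : ℝ) * √n = n := Real.mul_self_sqrt hn0.le
  have hs0 : 0 < √(n : ℝ) := by positivity
  have hdn : (d : ℝ) * 8 ≤ n := by nlinarith
  have hd2 : d ≤ n / 2 := by
    have : d * 8 ≤ n := by exact_mod_cast hdn
    omega
  refine ⟨hd2, ?_⟩
  set x : ℝ := (4 * d + 4) / n with hx
  have hx0 : 0 ≤ x := by positivity
  have hxs : x * √n ≤ 4 * (A + 1) := by
    rw [hx, div_mul_eq_mul_div, div_le_iff₀ hn0]
    nlinarith
  have hx2 : x ≤ 1 / 2 := by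
    have : x * √n ≤ 1 / 2 * √n := by nlinarith
    exact le_of_mul_le_mul_right this hs0
  have hxd : x * d ≤ 4 * (A + 1) * (A + 2) := by
    calc x * d ≤ x * (A * √n) := by gcongr
      _ = (x * √n) * A := by ring
      _ ≤ 4 * (A + 1) * (A + 2) := by
        apply mul_le_mul hxs (by linarith) hA.le (by positivity)
  have hexp : Real.exp (-(2 * x)) ≤ 1 - x := by
    rw [← Real.le_log_iff_exp_le (by linarith)]
    refine le_trans ?_ (Real.one_sub_inv_le_log_of_pos (by linarith))
    rw [le_sub_iff_add_le, ← le_sub_iff_add_le', inv_le_comm₀ (by linarith) (by linarith)]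
    rw [inv_le_iff_one_le_mul₀ (by linarith)]
    nlinarith
  rcases choose_half_sub_lower n d d hd2 le_rfl with h | h
  · have h1 := choose_half_lower n (by omega)
    have h2 : Real.exp (-(2 * (4 * (A + 1) * (A + 2)))) ≤ (1 - x) ^ d := by
      calc _ ≤ Real.exp (-(2 * x)) ^ d := by
            rw [← Real.exp_nat_mul]
            apply Real.exp_le_exp.2
            nlinarith
        _ ≤ _ := by gcongr
    calc _ = (1 / (2 * √n)) * Real.exp (-(2 * (4 * (A + 1) * (A + 2)))) := by
            field_simp
      _ ≤ ((n.choose (n / 2) : ℝ) / 2 ^ n) * (1 - x) ^ d := by gcongr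
      _ = ((n.choose (n / 2) : ℝ) * (1 - x) ^ d) / 2 ^ n := by ring
      _ ≤ _ := by gcongr
  · linarith

/-! ### Moments and laws of sums of independent signs -/

/-- The σ-algebra generated by the `X i`, `i ∈ I`, `i ≥ 1`. -/
abbrev sigmaOf {Ω : Type*} (X : ℕ → Ω → ℝ) (I : Set ℕ) : MeasurableSpace Ω :=
  ⨆ i ∈ {i : ℕ | i + 1 ∈ I}, MeasurableSpace.comap (X (i + 1)) inferInstance

lemma sigmaOf_mono {Ω : Type*} (X : ℕ → Ω → ℝ) {I J : Set ℕ} (h : I ⊆ J) :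
    sigmaOf X I ≤ sigmaOf X J :=
  biSup_mono fun _ hi => h hi

lemma measurable_sigmaOf {Ω : Type*} (X : ℕ → Ω → ℝ) {I : Set ℕ} {i : ℕ} (hi : i ∈ I)
    (hi1 : 1 ≤ i) : Measurable[sigmaOf X I] (X i) := by
  obtain ⟨j, rfl⟩ : ∃ j, i = j + 1 := ⟨i - 1, by omega⟩
  rw [measurable_iff_comap_le]
  exact le_iSup₂_of_le j hi le_rfl

lemma measurable_sum_sigmaOf {Ω : Type*} (X : ℕ → Ω → ℝ) (a : ℕ → ℝ) {I : Set ℕ}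
    {J : Finset ℕ} (hJ : ∀ i ∈ J, i ∈ I ∧ 1 ≤ i) :
    Measurable[sigmaOf X I] (fun ω => ∑ i ∈ J, a i * X i ω) := by
  refine @Finset.measurable_fun_sum _ _ _ _ _ _ (sigmaOf X I) _ _ fun i hi => ?_
  exact (measurable_const_mul (a i)).comp (measurable_sigmaOf X (hJ i hi).1 (hJ i hi).2)

lemma measurable_sum_one_sigmaOf {Ω : Type*} (X : ℕ → Ω → ℝ) {I : Set ℕ}
    {J : Finset ℕ} (hJ : ∀ i ∈ J, i ∈ I ∧ 1 ≤ i) :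
    Measurable[sigmaOf X I] (fun ω => ∑ i ∈ J, X i ω) := by
  simpa using measurable_sum_sigmaOf X (fun _ => 1) hJ

namespace IsRademacherSeq

variable {Ω : Type*} [mΩ : MeasurableSpace Ω] {μ : Measure Ω} {X : ℕ → Ω → ℝ}

lemma sigmaOf_le (hX : IsRademacherSeq μ X) (I : Set ℕ) : sigmaOf X I ≤ mΩ :=
  iSup₂_le fun i _ => (hX.measurable (i + 1) (by omega)).comap_le

lemma indep_sigmaOf (hX : IsRademacherSeq μ X) {I J : Set ℕ} (h : Disjoint I J) :
    Indep (sigmaOf X I) (sigmaOf X J) μ := by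
  refine indep_iSup_of_disjoint (fun i => (hX.measurable (i + 1) (by omega)).comap_le)
    hX.indep.iIndep ?_
  rw [Set.disjoint_left] at h ⊢
  exact fun i hi => h hi

protected lemma neg (hX : IsRademacherSeq μ X) : IsRademacherSeq μ (fun i ω => -X i ω) where
  measurable i hi := (hX.measurable i hi).neg
  indep := hX.indep.comp (fun _ x => -x) (fun _ => measurable_neg)
  prob_one i hi := by simpa [neg_eq_iff_eq_neg] using hX.prob_neg_one i hi
  prob_neg_one i hi := by simpa using hX.prob_one i hi

lemma measureReal_one (hX : IsRademacherSeq μ X) {i : ℕ} (hi : 1 ≤ i) :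
    μ.real {ω | X i ω = 1} = 1 / 2 := by simp [Measure.real, hX.prob_one i hi]

lemma measureReal_neg_one (hX : IsRademacherSeq μ X) {i : ℕ} (hi : 1 ≤ i) :
    μ.real {ω | X i ω = -1} = 1 / 2 := by simp [Measure.real, hX.prob_neg_one i hi]

lemma indepFun (hX : IsRademacherSeq μ X) {i j : ℕ} (hi : 1 ≤ i) (hj : 1 ≤ j) (hij : i ≠ j) :
    IndepFun (X i) (X j) μ := by
  obtain ⟨i, rfl⟩ : ∃ k, i = k + 1 := ⟨i - 1, by omega⟩
  obtain ⟨j, rfl⟩ : ∃ k, j = k + 1 := ⟨j - 1, by omega⟩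
  exact hX.indep.indepFun (by simpa using hij)

variable [IsProbabilityMeasure μ]

lemma ae_eq_or (hX : IsRademacherSeq μ X) : ∀ᵐ ω ∂μ, ∀ i, 1 ≤ i → X i ω = 1 ∨ X i ω = -1 := by
  rw [ae_all_iff]
  intro i
  by_cases hi : 1 ≤ i
  swap
  · simp [hi]
  have hm := hX.measurable i hi
  have h1 : MeasurableSet {ω | X i ω = 1} := hm (measurableSet_singleton 1)
  have h2 : MeasurableSet {ω | X i ω = -1} := hm (measurableSet_singleton (-1))
  have hd : Disjoint {ω | X i ω = 1} {ω | X i ω = -1} := by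
    rw [Set.disjoint_left]; intro ω h h'
    simp only [Set.mem_ofPred_eq] at h h'; linarith
  have h : μ ({ω | X i ω = 1} ∪ {ω | X i ω = -1}) = 1 := by
    rw [measure_union hd h2, hX.prob_one i hi, hX.prob_neg_one i hi, ENNReal.add_halves]
  have := (mem_ae_iff_prob_eq_one (h1.union h2)).2 h
  filter_upwards [this] with ω hω _ using hω

lemma integral_eq_zero (hX : IsRademacherSeq μ X) {i : ℕ} (hi : 1 ≤ i) : ∫ ω, X i ω ∂μ = 0 := by
  have hm := hX.measurable i hi
  have h1 : MeasurableSet {ω | X i ω = 1} := hm (measurableSet_singleton 1)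
  have h2 : MeasurableSet {ω | X i ω = -1} := hm (measurableSet_singleton (-1))
  have h : X i =ᵐ[μ] fun ω => {ω | X i ω = 1}.indicator (fun _ => (1 : ℝ)) ω -
      {ω | X i ω = -1}.indicator (fun _ => (1 : ℝ)) ω := by
    filter_upwards [hX.ae_eq_or] with ω hω
    rcases hω i hi with h | h <;> simp [Set.indicator, h] <;> norm_num
  rw [integral_congr_ae h, integral_sub ((integrable_const _).indicator h1)
    ((integrable_const _).indicator h2), integral_indicator h1, integral_indicator h2]
  simp [hX.measureReal_one hi, hX.measureReal_neg_one hi]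

lemma memLp_mul (hX : IsRademacherSeq μ X) (a : ℝ) {i : ℕ} (hi : 1 ≤ i) :
    MemLp (fun ω => a * X i ω) 2 μ := by
  refine MemLp.of_bound ((hX.measurable i hi).const_mul a).aestronglyMeasurable |a| ?_
  filter_upwards [hX.ae_eq_or] with ω hω
  rcases hω i hi with h | h <;> simp [h]

/-- Chebyshev's inequality for weighted sums with weights of modulus at most `b`. -/
lemma measureReal_abs_sum_ge_le (hX : IsRademacherSeq μ X) (a : ℕ → ℝ) (n : ℕ) {b t : ℝ}
    (ha : ∀ i, 1 ≤ i → i ≤ n → |a i| ≤ b) (ht : 0 < t) :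
    μ.real {ω | t ≤ |aWalk a X n ω|} ≤ b ^ 2 * n / t ^ 2 := by
  have hL : ∀ i ∈ Finset.Icc 1 n, MemLp (fun ω => a i * X i ω) 2 μ := fun i hi =>
    hX.memLp_mul _ (Finset.mem_Icc.1 hi).1
  have hsum : aWalk a X n = ∑ i ∈ Finset.Icc 1 n, fun ω => a i * X i ω := by
    ext ω; simp [aWalk]
  have hmean : ∫ ω, aWalk a X n ω ∂μ = 0 := by
    unfold aWalk
    rw [integral_finsetSum _ fun i hi => (hL i hi).integrable (by norm_num)]
    refine Finset.sum_eq_zero fun i hi => ?_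
    rw [integral_const_mul, hX.integral_eq_zero (Finset.mem_Icc.1 hi).1, mul_zero]
  have hvar : variance (aWalk a X n) μ ≤ b ^ 2 * n := by
    rw [hsum, IndepFun.variance_sum hL]
    · calc _ ≤ ∑ i ∈ Finset.Icc 1 n, b ^ 2 := by
            refine Finset.sum_le_sum fun i hi => ?_
            obtain ⟨h1, h2⟩ := Finset.mem_Icc.1 hi
            have hb := ha i h1 h2
            have := variance_le_sq_of_bounded (μ := μ) (X := fun ω => a i * X i ω) (a := -b) (b := b)
              (by
                filter_upwards [hX.ae_eq_or] with ω hω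
                rw [abs_le] at hb
                rcases hω i h1 with h | h <;> simp only [h, Set.mem_Icc] <;> constructor <;>
                  linarith [hb.1, hb.2])
              ((hX.measurable i h1).const_mul _).aemeasurable
            calc _ ≤ _ := this
              _ = b ^ 2 := by ring
        _ = _ := by simp; ring
    · intro i hi j hj hij
      have h1 := (Finset.mem_Icc.1 hi).1
      have h2 := (Finset.mem_Icc.1 hj).1
      exact (hX.indepFun h1 h2 hij).comp (measurable_const_mul _) (measurable_const_mul _)
  have hmem : MemLp (aWalk a X n) 2 μ := by
    rw [hsum]; exact memLp_finsetSum' _ hL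
  have h := meas_ge_le_variance_div_sq hmem ht
  rw [hmean] at h
  simp only [sub_zero] at h
  rw [Measure.real]
  refine (ENNReal.toReal_le_of_le_ofReal (div_nonneg (variance_nonneg _ _) (by positivity)) h).trans ?_
  gcongr

/-- Here `h` counts the signs `+1`. Conditioning on one more sign reproduces Pascal's rule; a lower
bound suffices, so the null set where a sign is not `±1` needs no attention. -/
lemma choose_le_measureReal_sum (hX : IsRademacherSeq μ X) (I : Finset ℕ) (hI : ∀ i ∈ I, 1 ≤ i)
    (h : ℕ) : (I.card.choose h : ℝ) / 2 ^ I.card ≤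
      μ.real {ω | ∑ i ∈ I, X i ω = 2 * (h : ℝ) - I.card} := by
  induction I using Finset.induction_on generalizing h with
  | empty =>
    rcases Nat.eq_zero_or_pos h with rfl | hh
    · simp
    · rw [Finset.card_empty, Nat.choose_eq_zero_of_lt hh]; simp
  | insert i I hi ih =>
    have hI' : ∀ j ∈ I, 1 ≤ j := fun j hj => hI j (Finset.mem_insert_of_mem hj)
    have hi1 : 1 ≤ i := hI i (Finset.mem_insert_self _ _)
    have ih := ih hI'
    have hind : Indep (sigmaOf X {i}) (sigmaOf X (I : Set ℕ)) μ :=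
      hX.indep_sigmaOf (by simpa using hi)
    have hXi : Measurable[sigmaOf X {i}] (X i) := measurable_sigmaOf X rfl hi1
    have hSI : Measurable[sigmaOf X (I : Set ℕ)] (fun ω => ∑ j ∈ I, X j ω) :=
      measurable_sum_one_sigmaOf X fun j hj => ⟨hj, hI' j hj⟩
    have hprod : ∀ x v : ℝ, μ.real ({ω | X i ω = x} ∩ {ω | ∑ j ∈ I, X j ω = v}) =
        μ.real {ω | X i ω = x} * μ.real {ω | ∑ j ∈ I, X j ω = v} := by
      intro x v
      simp only [Measure.real]
      rw [← ENNReal.toReal_mul]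
      congr 1
      exact (Indep_iff _ _ μ).1 hind _ _ (hXi (measurableSet_singleton x))
        (hSI (measurableSet_singleton v))
    have hms : ∀ x v : ℝ, MeasurableSet ({ω | X i ω = x} ∩ {ω | ∑ j ∈ I, X j ω = v}) :=
      fun x v => ((hX.sigmaOf_le _) _ (hXi (measurableSet_singleton x))).inter
        ((hX.sigmaOf_le _) _ (hSI (measurableSet_singleton v)))
    rw [Finset.card_insert_of_notMem hi]
    simp only [Finset.sum_insert hi]
    have hdown : ({ω | X i ω = -1} ∩ {ω | ∑ j ∈ I, X j ω = 2 * (h : ℝ) - I.card}) ⊆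
        {ω | X i ω + ∑ j ∈ I, X j ω = 2 * (h : ℝ) - ((I.card + 1 : ℕ) : ℝ)} := by
      rintro ω ⟨h1, h2⟩
      simp only [Set.mem_ofPred_eq] at *
      rw [h1, h2]; push_cast; ring
    rcases h with _ | h
    · calc _ = 1 / 2 * (((I.card.choose 0 : ℕ) : ℝ) / 2 ^ I.card) := by
            simp [pow_succ]
        _ ≤ _ := mul_le_mul_of_nonneg_left (ih 0) (by norm_num)
        _ = _ := by rw [← hX.measureReal_neg_one hi1, ← hprod]
        _ ≤ _ := measureReal_mono hdown
    · have hup : ({ω | X i ω = 1} ∩ {ω | ∑ j ∈ I, X j ω = 2 * (h : ℝ) - I.card}) ⊆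
          {ω | X i ω + ∑ j ∈ I, X j ω = 2 * ((h + 1 : ℕ) : ℝ) - ((I.card + 1 : ℕ) : ℝ)} := by
        rintro ω ⟨h1, h2⟩
        simp only [Set.mem_ofPred_eq] at *
        rw [h1, h2]; push_cast; ring
      calc _ = 1 / 2 * (((I.card.choose h : ℕ) : ℝ) / 2 ^ I.card) +
            1 / 2 * (((I.card.choose (h + 1) : ℕ) : ℝ) / 2 ^ I.card) := by
            rw [Nat.choose_succ_succ, pow_succ]; push_cast; ring
        _ ≤ 1 / 2 * μ.real {ω | ∑ j ∈ I, X j ω = 2 * (h : ℝ) - I.card} +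
            1 / 2 * μ.real {ω | ∑ j ∈ I, X j ω = 2 * ((h + 1 : ℕ) : ℝ) - I.card} := by
            gcongr
            · exact ih h
            · exact ih (h + 1)
        _ = μ.real (({ω | X i ω = 1} ∩ {ω | ∑ j ∈ I, X j ω = 2 * (h : ℝ) - I.card}) ∪
              ({ω | X i ω = -1} ∩ {ω | ∑ j ∈ I, X j ω = 2 * ((h + 1 : ℕ) : ℝ) - I.card})) := by
            rw [measureReal_union _ (hms _ _), hprod, hprod, hX.measureReal_neg_one hi1,
              hX.measureReal_one hi1]
            rw [Set.disjoint_left]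
            rintro ω ⟨h1, _⟩ ⟨h2, _⟩
            simp only [Set.mem_ofPred_eq] at h1 h2
            linarith
        _ ≤ _ := measureReal_mono (Set.union_subset hup hdown)

end IsRademacherSeq

/-! ### Hitting zero during two consecutive blocks -/

/-- A nearest-neighbour path on `k ℤ` that passes from `≤ 0` to `≥ 0` visits `0`. -/
lemma exists_eq_zero_of_steps (W : ℕ → ℝ) {p q : ℕ} (hpq : p ≤ q) (k : ℝ) (hk : 0 < k)
    (hstep : ∀ i, p ≤ i → i < q → W (i + 1) = W i + k ∨ W (i + 1) = W i - k)
    (x : ℤ) (hx : W p = k * x) (hp : W p ≤ 0) (hq : 0 ≤ W q) :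
    ∃ n, p ≤ n ∧ n ≤ q ∧ W n = 0 := by
  have key : ∀ d, p + d ≤ q → (∃ n, p ≤ n ∧ n ≤ q ∧ W n = 0) ∨
      ∃ y : ℤ, W (p + d) = k * y ∧ y < 0 := by
    intro d
    induction d with
    | zero =>
      intro _
      rcases hp.lt_or_eq with h | h
      · refine Or.inr ⟨x, hx, ?_⟩
        rw [hx] at h
        by_contra! h0
        have : (0 : ℝ) ≤ x := by exact_mod_cast h0
        nlinarith
      · exact Or.inl ⟨p, le_rfl, hpq, h⟩
    | succ d ih =>
      intro hd
      rcases ih (by omega) with h | ⟨y, hy, hy0⟩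
      · exact Or.inl h
      rcases hstep (p + d) (by omega) (by omega) with h | h
      · rcases (by omega : y + 1 < 0 ∨ y + 1 = 0) with h1 | h1
        · refine Or.inr ⟨y + 1, ?_, h1⟩
          rw [← add_assoc, h, hy]; push_cast; ring
        · refine Or.inl ⟨p + d + 1, by omega, by omega, ?_⟩
          have : (y : ℝ) + 1 = 0 := by exact_mod_cast h1
          rw [h, hy]; linear_combination k * this
      · refine Or.inr ⟨y - 1, ?_, by omega⟩
        rw [← add_assoc, h, hy]; push_cast; ring
  rcases key (q - p) (by omega) with h | ⟨y, hy, hy0⟩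
  · exact h
  · rw [show p + (q - p) = q by omega] at hy
    have : (y : ℝ) < 0 := by exact_mod_cast hy0
    nlinarith

/-- The non-positive integers `u ≥ -3 √m` for which `s + (k - 1) u` is divisible by `k`. -/
def residueWindow (k m : ℕ) (s : ℤ) : Set ℝ :=
  {x | ∃ u : ℤ, x = u ∧ (k : ℤ) ∣ s + (k - 1) * u ∧ u ≤ 0 ∧ -(3 * √m) ≤ (u : ℝ)}

lemma measurableSet_residueWindow (k m : ℕ) (s : ℤ) : MeasurableSet (residueWindow k m s) := by
  refine Set.Countable.measurableSet ((Set.countable_range (fun u : ℤ => (u : ℝ))).mono ?_)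
  rintro x ⟨u, rfl, _⟩
  exact ⟨u, rfl⟩

/-- For `k = 2t + 1` one has `2t ≡ -1` modulo `k`, so `d ≡ bt` works. -/
lemma exists_residue (k : ℕ) (hk : Odd k) (b : ℤ) : ∃ d : ℕ, d < k ∧ (k : ℤ) ∣ b + 2 * d := by
  have hk0 : (0 : ℤ) < k := by exact_mod_cast hk.pos
  obtain ⟨t, ht⟩ := hk
  refine ⟨((b * t) % k).toNat, ?_, ?_⟩
  · have h1 := Int.emod_nonneg (b * t) hk0.ne'
    have h2 := Int.emod_lt_of_pos (b * t) hk0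
    omega
  · rw [Int.toNat_of_nonneg (Int.emod_nonneg _ hk0.ne')]
    have h := Int.emod_add_mul_ediv (b * t) k
    have hkt : (k : ℤ) = 2 * t + 1 := by exact_mod_cast ht
    refine ⟨b - 2 * (b * t / k), ?_⟩
    have h' : b * t % k = b * t - k * (b * t / k) := by linarith
    rw [h']
    linear_combination (-b) * hkt

namespace IsRademacherSeq

variable {Ω : Type*} [mΩ : MeasurableSpace Ω] (μ : Measure Ω) [IsProbabilityMeasure μ]

/-- Each distance `d ≤ A√n` below the centre is an atom of mass at least `c/√n`, so counting the
admissible `d` bounds the probability of `B`. -/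
lemma exists_measureReal_sum_mem_lower (A : ℝ) (hA : 0 < A) :
    ∃ c : ℝ, 0 < c ∧ ∃ n₀ : ℕ, 1 ≤ n₀ ∧ ∀ X : ℕ → Ω → ℝ, IsRademacherSeq μ X →
      ∀ I : Finset ℕ, (∀ i ∈ I, 1 ≤ i) → n₀ ≤ I.card → ∀ (T : Finset ℕ) (B : Set ℝ),
      (∀ d ∈ T, (d : ℝ) ≤ A * √I.card ∧
        (d ≤ I.card / 2 → 2 * ((I.card / 2 - d : ℕ) : ℝ) - I.card ∈ B)) →
      T.card * (c / √I.card) ≤ μ.real {ω | ∑ i ∈ I, X i ω ∈ B} := by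
  obtain ⟨c, hc, n₀, hn₀, h⟩ := exists_choose_lower A hA
  refine ⟨c, hc, n₀, hn₀, fun X hX I hI hcard T B hT => ?_⟩
  have hmeas : Measurable (fun ω => ∑ i ∈ I, X i ω) :=
    (measurable_sum_one_sigmaOf X (I := Set.univ) fun j hj => ⟨trivial, hI j hj⟩).mono
      (hX.sigmaOf_le _) le_rfl
  calc T.card * (c / √I.card) = ∑ d ∈ T, c / √I.card := by simp
    _ ≤ ∑ d ∈ T, μ.real {ω | ∑ i ∈ I, X i ω = 2 * ((I.card / 2 - d : ℕ) : ℝ) - I.card} :=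
      Finset.sum_le_sum fun d hd => (h _ d hcard (hT d hd).1).2.trans
        (hX.choose_le_measureReal_sum I hI _)
    _ = μ.real (⋃ d ∈ T, {ω | ∑ i ∈ I, X i ω = 2 * ((I.card / 2 - d : ℕ) : ℝ) - I.card}) := by
      rw [measureReal_biUnion_finset]
      · intro d hd e he hde
        simp only [Function.onFun]
        rw [Set.disjoint_left]
        intro ω h1 h2
        simp only [Set.mem_ofPred_eq] at h1 h2
        have h3 : ((I.card / 2 - d : ℕ) : ℝ) = ((I.card / 2 - e : ℕ) : ℝ) := by linarith
        have h3' : I.card / 2 - d = I.card / 2 - e := by exact_mod_cast h3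
        have h4 := (h _ d hcard (hT d hd).1).1
        have h5 := (h _ e hcard (hT e he).1).1
        omega
      · exact fun d _ => hmeas (measurableSet_singleton _)
    _ ≤ _ := by
      refine measureReal_mono ?_
      simp only [Set.iUnion_subset_iff]
      intro d hd ω hω
      simp only [Set.mem_ofPred_eq] at hω ⊢
      rw [hω]
      exact (hT d hd).2 (h _ d hcard (hT d hd).1).1

/-- The admissible distances form a progression of difference `k` inside `[0, √m]`: about `√m / k`
atoms of mass `c/√m` each. The hypothesis `k ^ 2 ≤ m` makes this count positive. -/
lemma exists_measureReal_residueWindow_lower :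
    ∃ c : ℝ, 0 < c ∧ ∃ n₀ : ℕ, 1 ≤ n₀ ∧ ∀ X : ℕ → Ω → ℝ, IsRademacherSeq μ X →
      ∀ I : Finset ℕ, (∀ i ∈ I, 1 ≤ i) → n₀ ≤ I.card → ∀ k : ℕ, Odd k → k ^ 2 ≤ I.card →
      ∀ s : ℤ, c / k ≤ μ.real {ω | ∑ i ∈ I, X i ω ∈ residueWindow k I.card s} := by
  obtain ⟨c, hc, n₀, hn₀, h⟩ := exists_measureReal_sum_mem_lower μ 1 one_pos
  refine ⟨c / 4, by positivity, n₀, hn₀, fun X hX I hI hcard k hk hk2 s => ?_⟩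
  set m := I.card with hm
  have hk0 : 0 < k := hk.pos
  have hm1 : (1 : ℝ) ≤ m := by exact_mod_cast hn₀.trans hcard
  have hsm : 1 ≤ √(m : ℝ) := Real.one_le_sqrt.2 hm1
  -- Modulo `k`, `s + (k-1)u ≡ s - u`, and `u = 2(m/2 - d) - m` turns this into the expression below
  -- plus `2d`.
  obtain ⟨d₀, hd₀, hdvd⟩ := exists_residue k hk (s - 2 * (m / 2 : ℕ) + m)
  set D := Nat.sqrt m with hD
  have hkD : k ≤ D := Nat.le_sqrt'.2 hk2
  have hDm : (D : ℝ) ≤ √m := Real.le_sqrt_of_sq_le (by exact_mod_cast Nat.sqrt_le' m)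
  have hDm' : √m ≤ D + 1 := by
    rw [Real.sqrt_le_left (by positivity)]
    exact_mod_cast (Nat.lt_succ_sqrt' m).le
  set T : Finset ℕ := (Finset.range (D / k)).image (fun t => d₀ + k * t) with hT
  have hTcard : T.card = D / k := by
    rw [hT, Finset.card_image_of_injective, Finset.card_range]
    intro a b hab
    have : k * a = k * b := by simpa using hab
    exact Nat.eq_of_mul_eq_mul_left hk0 this
  have hTmem : ∀ d ∈ T, d ≤ D ∧ (k : ℤ) ∣ s - 2 * (m / 2 : ℕ) + m + 2 * d := by
    intro d hd
    obtain ⟨t, ht, rfl⟩ := Finset.mem_image.1 hd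
    rw [Finset.mem_range] at ht
    constructor
    · have h1 : k * (t + 1) ≤ k * (D / k) := Nat.mul_le_mul_left _ ht
      have h2 := Nat.mul_div_le D k
      rw [mul_add, mul_one] at h1
      omega
    · obtain ⟨e, he⟩ := hdvd
      exact ⟨e + 2 * t, by simp only [Nat.cast_add, Nat.cast_mul]; linear_combination he⟩
  refine le_trans ?_ (h X hX I hI hcard T (residueWindow k m s) ?_)
  · have hcnt : √(m : ℝ) ≤ 4 * k * T.card := by
      rw [hTcard]
      have h1 : D + 1 ≤ 4 * k * (D / k) := by
        have h2 := Nat.div_add_mod D k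
        have h3 := Nat.mod_lt D hk0
        have h4 : 1 ≤ D / k := (Nat.one_le_div_iff hk0).2 hkD
        have h5 : k ≤ k * (D / k) := Nat.le_mul_of_pos_right _ h4
        have : 4 * k * (D / k) = 4 * (k * (D / k)) := by ring
        omega
      exact hDm'.trans (by exact_mod_cast h1)
    have hkr : (0 : ℝ) < k := by exact_mod_cast hk0
    rw [div_div, mul_div_assoc', div_le_div_iff₀ (by positivity) (by positivity)]
    nlinarith
  · intro d hd
    obtain ⟨h1, h2⟩ := hTmem d hd
    have h1' : (d : ℝ) ≤ √m := le_trans (by exact_mod_cast h1) hDm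
    refine ⟨by rw [one_mul]; exact h1', fun hd2 => ?_⟩
    refine ⟨2 * ((m / 2 - d : ℕ) : ℤ) - m, ?_, ?_, by omega, ?_⟩
    · simp only [Int.cast_sub, Int.cast_mul, Int.cast_natCast, Int.cast_ofNat]; rfl
    · rw [Nat.cast_sub hd2]
      obtain ⟨e, he⟩ := h2
      exact ⟨e + (2 * ((m / 2 : ℕ) - d : ℤ) - m), by linear_combination he⟩
    -- The constant 3 of the window: `u ≥ -2d - 1 ≥ -2√m - 1 ≥ -3√m`.
    · have h6 : (m : ℤ) ≤ 2 * ((m / 2 - d : ℕ) : ℤ) + 2 * d + 1 := by omega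
      have h6' : (m : ℝ) ≤ 2 * ((m / 2 - d : ℕ) : ℝ) + 2 * d + 1 := by exact_mod_cast h6
      simp only [Int.cast_sub, Int.cast_mul, Int.cast_natCast, Int.cast_ofNat]
      linarith

/-- About `√n` distances `d` between `K√n` and `(K+2)√n`, each of mass at least `c/√n`, stand in for
the central limit theorem. -/
lemma exists_measureReal_sum_le_lower (K : ℝ) (hK : 0 < K) :
    ∃ c : ℝ, 0 < c ∧ ∃ n₀ : ℕ, 1 ≤ n₀ ∧ ∀ X : ℕ → Ω → ℝ, IsRademacherSeq μ X →
      ∀ I : Finset ℕ, (∀ i ∈ I, 1 ≤ i) → n₀ ≤ I.card →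
      c ≤ μ.real {ω | ∑ i ∈ I, X i ω ∈ Set.Iic (-(K * √I.card))} := by
  obtain ⟨c, hc, n₀, hn₀, h⟩ := exists_measureReal_sum_mem_lower μ (K + 2) (by positivity)
  refine ⟨c, hc, n₀, hn₀, fun X hX I hI hcard => ?_⟩
  set n := I.card with hn
  have hn1 : (1 : ℝ) ≤ n := by exact_mod_cast hn₀.trans hcard
  have hsn : 1 ≤ √(n : ℝ) := Real.one_le_sqrt.2 hn1
  have hs0 : 0 < √(n : ℝ) := by linarith
  have hfl := Nat.floor_le hs0.le
  have hfl' := Nat.lt_floor_add_one (√(n : ℝ))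
  have hce := Nat.le_ceil (K * √n)
  have hce' := Nat.ceil_lt_add_one (mul_pos hK hs0).le
  refine le_trans ?_ (h X hX I hI hcard
    (Finset.Icc ⌈K * √n⌉₊ (⌈K * √n⌉₊ + ⌊√(n : ℝ)⌋₊)) _ ?_)
  · rw [Nat.card_Icc, show ⌈K * √n⌉₊ + ⌊√(n : ℝ)⌋₊ + 1 - ⌈K * √n⌉₊ = ⌊√(n : ℝ)⌋₊ + 1 by omega,
      mul_div_assoc', le_div_iff₀ hs0, mul_comm]
    push_cast
    gcongr
  · intro d hd
    obtain ⟨h1, h2⟩ := Finset.mem_Icc.1 hd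
    have h1' : (⌈K * √n⌉₊ : ℝ) ≤ d := by exact_mod_cast h1
    have h2' : (d : ℝ) ≤ ⌈K * √n⌉₊ + ⌊√(n : ℝ)⌋₊ := by exact_mod_cast h2
    refine ⟨by nlinarith, fun hd2 => ?_⟩
    have h6 : 2 * (n / 2 - d) + 2 * d ≤ n := by omega
    have h6' : 2 * ((n / 2 - d : ℕ) : ℝ) + 2 * d ≤ n := by exact_mod_cast h6
    rw [Set.mem_Iic]
    nlinarith

end IsRademacherSeq

lemma aWalk_neg {Ω : Type*} (a : ℕ → ℝ) (X : ℕ → Ω → ℝ) (n : ℕ) (ω : Ω) :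
    aWalk a (fun i ω => -X i ω) n ω = -aWalk a X n ω := by
  simp [aWalk]

lemma aWalk_succ {Ω : Type*} (a : ℕ → ℝ) (X : ℕ → Ω → ℝ) (n : ℕ) (ω : Ω) :
    aWalk a X (n + 1) ω = aWalk a X n ω + a (n + 1) * X (n + 1) ω := by
  rw [aWalk, Finset.sum_Icc_succ_top (by omega), aWalk]

lemma aWalk_eq_add {Ω : Type*} (a : ℕ → ℝ) (X : ℕ → Ω → ℝ) {p q : ℕ} (hpq : p ≤ q) {b : ℝ}
    (ha : ∀ i, p < i → i ≤ q → a i = b) (ω : Ω) :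
    aWalk a X q ω = aWalk a X p ω + b * ∑ i ∈ Finset.Ioc p q, X i ω := by
  induction q, hpq using Nat.le_induction with
  | base => simp
  | succ q hq ih =>
    rw [aWalk_succ, ih (fun i h1 h2 => ha i h1 (by omega)), ha (q + 1) (by omega) le_rfl,
      Finset.sum_Ioc_succ_top hq]
    ring

lemma sigmaOf_neg_le {Ω : Type*} (X : ℕ → Ω → ℝ) (I : Set ℕ) :
    sigmaOf (fun i ω => -X i ω) I ≤ sigmaOf X I := by
  refine iSup₂_le fun i hi => ?_
  rw [← measurable_iff_comap_le]
  exact measurable_neg.comp (measurable_sigmaOf X hi (by omega))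

namespace IsRademacherSeq

variable {Ω : Type*} [mΩ : MeasurableSpace Ω] (μ : Measure Ω) [IsProbabilityMeasure μ]

/-- `F` asks two independent things: block `k - 1` puts the walk at a non-positive multiple of `k`,
not much lower than `s` (probability of order `1/k`), and block `k` then climbs back past `0`
(probability bounded below). `F` depends on `s` but only on signs after `p₀`, so it is independent
of the past. -/
lemma exists_hit_lower_of_nonpos (C M : ℝ) (hC : 0 < C) (hM : 0 < M) :
    ∃ c : ℝ, 0 < c ∧ ∃ n₀ : ℕ, ∀ X : ℕ → Ω → ℝ, IsRademacherSeq μ X →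
      ∀ p₀ p₁ p₂ k : ℕ, n₀ + p₀ ≤ p₁ → n₀ + p₁ ≤ p₂ → Odd k → k ^ 2 + p₀ ≤ p₁ →
      ((p₁ - p₀ : ℕ) : ℝ) ≤ M * (p₂ - p₁ : ℕ) →
      ∀ s : ℤ, s ≤ 0 → -(C * k * √(p₂ - p₁ : ℕ)) ≤ s →
      ∃ F : Set Ω, MeasurableSet[sigmaOf X (Set.Ioc p₀ p₂)] F ∧ c / k ≤ μ.real F ∧
        ∀ a : ℕ → ℝ, (∀ i, p₀ < i → i ≤ p₁ → a i = k - 1) → (∀ i, p₁ < i → i ≤ p₂ → a i = k) →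
        ∀ ω ∈ F, (∀ i, 1 ≤ i → X i ω = 1 ∨ X i ω = -1) → aWalk a X p₀ ω = s →
        ∃ n, p₁ ≤ n ∧ n ≤ p₂ ∧ aWalk a X n ω = 0 := by
  obtain ⟨c₁, hc₁, n₁, hn₁, h₁⟩ := exists_measureReal_residueWindow_lower μ
  -- The climb must make up for `|s| ≤ Ck√n` and for the descent in block `k - 1`, at most `3k√m ≤
  -- 3k√M√n`.
  obtain ⟨c₂, hc₂, n₂, hn₂, h₂⟩ := exists_measureReal_sum_le_lower μ (C + 3 * √M) (by positivity)
  refine ⟨c₁ * c₂, by positivity, max n₁ n₂, fun X hX p₀ p₁ p₂ k hp₁ hp₂ hk hk2 hMn s hs hsC => ?_⟩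
  have hn₁' : n₁ ≤ p₁ - p₀ := by have := le_max_left n₁ n₂; omega
  have hn₂' : n₂ ≤ p₂ - p₁ := by have := le_max_right n₁ n₂; omega
  have e1 : (Finset.Ioc p₀ p₁).card = p₁ - p₀ := Nat.card_Ioc _ _
  have e2 : (Finset.Ioc p₁ p₂).card = p₂ - p₁ := Nat.card_Ioc _ _
  have hU := h₁ X hX (Finset.Ioc p₀ p₁) (fun i hi => by rw [Finset.mem_Ioc] at hi; omega)
    (by rwa [e1]) k hk (by rw [e1]; omega) s
  -- Applying the lower-tail bound to `-X` gives the upper tail of `X`.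
  have hV := h₂ _ hX.neg (Finset.Ioc p₁ p₂) (fun i hi => by rw [Finset.mem_Ioc] at hi; omega)
    (by rwa [e2])
  rw [e1] at hU
  rw [e2] at hV
  simp only [Finset.sum_neg_distrib] at hV
  have hk0 : (0 : ℝ) < k := by exact_mod_cast hk.pos
  have hk1 : (1 : ℝ) ≤ k := by exact_mod_cast hk.pos
  have mU : Measurable[sigmaOf X (Set.Ioc p₀ p₁)] (fun ω => ∑ i ∈ Finset.Ioc p₀ p₁, X i ω) :=
    measurable_sum_one_sigmaOf X fun j hj => by
      rw [Finset.mem_Ioc] at hj; exact ⟨hj, by omega⟩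
  have mV : Measurable[sigmaOf X (Set.Ioc p₁ p₂)] (fun ω => -∑ i ∈ Finset.Ioc p₁ p₂, X i ω) :=
    measurable_neg.comp (measurable_sum_one_sigmaOf X fun j hj => by
      rw [Finset.mem_Ioc] at hj; exact ⟨hj, by omega⟩)
  have mA := mU (measurableSet_residueWindow k (p₁ - p₀) s)
  have mB := mV (measurableSet_Iic (a := -((C + 3 * √M) * √((p₂ - p₁ : ℕ) : ℝ))))
  refine ⟨_, MeasurableSet.inter (sigmaOf_mono X (Set.Ioc_subset_Ioc_right (by omega)) _ mA)
    (sigmaOf_mono X (Set.Ioc_subset_Ioc_left (by omega)) _ mB), ?_, ?_⟩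
  · have hind : Indep (sigmaOf X (Set.Ioc p₀ p₁)) (sigmaOf X (Set.Ioc p₁ p₂)) μ :=
      hX.indep_sigmaOf (by
        rw [Set.disjoint_left]; intro i h1 h2
        rw [Set.mem_Ioc] at h1 h2; omega)
    rw [Measure.real, (Indep_iff _ _ μ).1 hind _ _ mA mB, ENNReal.toReal_mul]
    calc c₁ * c₂ / k = c₁ / k * c₂ := by ring
      _ ≤ _ := mul_le_mul hU hV hc₂.le measureReal_nonneg
  · rintro a ha₁ ha₂ ω ⟨hωU, hωV⟩ hω hS
    obtain ⟨u, hu, ⟨x, hx⟩, hu0, hu3⟩ := hωU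
    simp only [Set.mem_preimage, Set.mem_Iic] at hωV
    have hS1 := aWalk_eq_add a X (by omega : p₀ ≤ p₁) ha₁ ω
    have hS2 := aWalk_eq_add a X (by omega : p₁ ≤ p₂) ha₂ ω
    simp only at hu
    rw [hS, hu] at hS1
    have hx' : (s : ℝ) + (k - 1) * u = k * x := by exact_mod_cast hx
    have hs' : (s : ℝ) ≤ 0 := by exact_mod_cast hs
    have hu0' : (u : ℝ) ≤ 0 := by exact_mod_cast hu0
    have hsqrt : √((p₁ - p₀ : ℕ) : ℝ) ≤ √M * √((p₂ - p₁ : ℕ) : ℝ) := by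
      rw [← Real.sqrt_mul hM.le]; exact Real.sqrt_le_sqrt hMn
    refine exists_eq_zero_of_steps (fun n => aWalk a X n ω) (by omega) k hk0 ?_ x ?_ ?_ ?_
    · intro i hi1 hi2
      simp only [aWalk_succ]
      rw [ha₂ (i + 1) (by omega) (by omega)]
      rcases hω (i + 1) (by omega) with h | h
      · left; rw [h, mul_one]
      · right; rw [h]; ring
    · exact hS1.trans hx'
    · simp only [hS1]; nlinarith
    · simp only [hS2, hS1]
      have h3 : (k : ℝ) * ((C + 3 * √M) * √((p₂ - p₁ : ℕ) : ℝ)) ≤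
          k * ∑ i ∈ Finset.Ioc p₁ p₂, X i ω := by
        gcongr; linarith
      have h4 : -((k : ℝ) * (3 * (√M * √((p₂ - p₁ : ℕ) : ℝ)))) ≤ (k - 1) * u := by
        have h5 : (k : ℝ) * u ≤ (k - 1) * u := by linarith
        have h6 : (k : ℝ) * (-(3 * (√M * √((p₂ - p₁ : ℕ) : ℝ)))) ≤ k * u := by
          gcongr; linarith
        linarith
      linarith

/-- Positive starting points reduce to non-positive ones by reflecting all signs. -/
lemma exists_hit_lower (C M : ℝ) (hC : 0 < C) (hM : 0 < M) :
    ∃ c : ℝ, 0 < c ∧ ∃ n₀ : ℕ, ∀ X : ℕ → Ω → ℝ, IsRademacherSeq μ X →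
      ∀ p₀ p₁ p₂ k : ℕ, n₀ + p₀ ≤ p₁ → n₀ + p₁ ≤ p₂ → Odd k → k ^ 2 + p₀ ≤ p₁ →
      ((p₁ - p₀ : ℕ) : ℝ) ≤ M * (p₂ - p₁ : ℕ) →
      ∀ s : ℤ, |(s : ℝ)| ≤ C * k * √(p₂ - p₁ : ℕ) →
      ∃ F : Set Ω, MeasurableSet[sigmaOf X (Set.Ioc p₀ p₂)] F ∧ c / k ≤ μ.real F ∧
        ∀ a : ℕ → ℝ, (∀ i, p₀ < i → i ≤ p₁ → a i = k - 1) → (∀ i, p₁ < i → i ≤ p₂ → a i = k) →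
        ∀ ω ∈ F, (∀ i, 1 ≤ i → X i ω = 1 ∨ X i ω = -1) → aWalk a X p₀ ω = s →
        ∃ n, p₁ ≤ n ∧ n ≤ p₂ ∧ aWalk a X n ω = 0 := by
  obtain ⟨c, hc, n₀, h⟩ := exists_hit_lower_of_nonpos μ C M hC hM
  refine ⟨c, hc, n₀, fun X hX p₀ p₁ p₂ k hp₁ hp₂ hk hk2 hMn s hs => ?_⟩
  rw [abs_le] at hs
  rcases le_total s 0 with hs0 | hs0
  · exact h X hX p₀ p₁ p₂ k hp₁ hp₂ hk hk2 hMn s hs0 hs.1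
  · obtain ⟨F, hF, hcF, hit⟩ := h _ hX.neg p₀ p₁ p₂ k hp₁ hp₂ hk hk2 hMn (-s) (by omega)
      (by push_cast; linarith [hs.2])
    refine ⟨F, sigmaOf_neg_le X _ _ hF, hcF, fun a ha₁ ha₂ ω hω hX1 hS => ?_⟩
    obtain ⟨n, hn1, hn2, hn⟩ := hit a ha₁ ha₂ ω hω
      (fun i hi => by
        rcases hX1 i hi with h | h
        · right; rw [h]
        · left; rw [h, neg_neg])
      (by rw [aWalk_neg, hS]; push_cast; rfl)
    exact ⟨n, hn1, hn2, by rw [aWalk_neg] at hn; linarith⟩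

end IsRademacherSeq

/-! ### Conditional probabilities and divergence of random sums -/

/-- Almost surely `1_E ≥ 1_{Z = s} 1_F`; conditioning on `m` pulls out the first factor and replaces
the second by its mean. This turns `F` into a lower bound for the conditional probability of a hit.
-/
lemma le_condExp_indicator_of_indep {Ω : Type*} {m m' mΩ : MeasurableSpace Ω}
    {μ : Measure Ω} [IsProbabilityMeasure μ] (hm : m ≤ mΩ) (hm' : m' ≤ mΩ)
    (hind : Indep m' m μ) {E F : Set Ω} (hE : MeasurableSet E) (hF : MeasurableSet[m'] F)
    {Z : Ω → ℝ} (hZ : Measurable[m] Z) (s : ℝ) (h : ∀ᵐ ω ∂μ, ω ∈ F → Z ω = s → ω ∈ E) :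
    ∀ᵐ ω ∂μ, Z ω = s → μ.real F ≤ (μ[E.indicator (1 : Ω → ℝ) | m]) ω := by
  have hG : MeasurableSet[m] {ω | Z ω = s} := hZ (measurableSet_singleton s)
  have hFm : MeasurableSet F := hm' _ hF
  have hfm : StronglyMeasurable[m] ({ω | Z ω = s}.indicator (1 : Ω → ℝ)) :=
    (@stronglyMeasurable_one _ _ m _ _).indicator hG
  have hgm : StronglyMeasurable[m'] (F.indicator (1 : Ω → ℝ)) :=
    (@stronglyMeasurable_one _ _ m' _ _).indicator hF
  have hgi : Integrable (F.indicator (1 : Ω → ℝ)) μ := (integrable_const (1 : ℝ)).indicator hFm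
  have hprod : {ω | Z ω = s}.indicator (1 : Ω → ℝ) * F.indicator (1 : Ω → ℝ) =
      ({ω | Z ω = s} ∩ F).indicator (1 : Ω → ℝ) := by
    rw [Set.inter_indicator_one]
  have hfgi : Integrable ({ω | Z ω = s}.indicator (1 : Ω → ℝ) * F.indicator (1 : Ω → ℝ)) μ := by
    rw [hprod]; exact (integrable_const (1 : ℝ)).indicator ((hm _ hG).inter hFm)
  have h1 := condExp_mul_of_stronglyMeasurable_left hfm hfgi hgi
  have h2 := condExp_indep_eq hm' hm hgm hind
  have h3 : μ[{ω | Z ω = s}.indicator (1 : Ω → ℝ) * F.indicator (1 : Ω → ℝ) | m] ≤ᵐ[μ]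
      μ[E.indicator (1 : Ω → ℝ) | m] := by
    refine condExp_mono hfgi ((integrable_const (1 : ℝ)).indicator hE) ?_
    filter_upwards [h] with ω hω
    rw [hprod]
    by_cases hx : ω ∈ {ω | Z ω = s} ∩ F
    · simp [Set.indicator_of_mem hx, Set.indicator_of_mem (hω hx.2 hx.1)]
    · rw [Set.indicator_of_notMem hx]
      exact Set.indicator_nonneg (fun _ _ => zero_le_one) ω
  filter_upwards [h1, h2, h3] with ω e1 e2 e3 hω
  rw [e1, Pi.mul_apply, e2, Set.indicator_of_mem (by exact hω)] at e3
  rw [integral_indicator_one hFm] at e3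
  simpa using e3

/-- If the weights have infinite sum and each `A j` has probability at least `1 - δ`, then the
total weight of the `A j` that occur is infinite with probability at least `1 - δ`. -/
lemma measure_not_tendsto_weighted_sum_le {Ω : Type*} [MeasurableSpace Ω] {μ : Measure Ω}
    [IsProbabilityMeasure μ] {w : ℕ → ℝ} (hw : ∀ j, 0 ≤ w j)
    (hdiv : Tendsto (fun n => ∑ j ∈ Finset.range n, w j) atTop atTop)
    {A : ℕ → Set Ω} (hA : ∀ j, MeasurableSet (A j)) {δ : ℝ}
    (hδ : ∀ j, w j * μ.real (A j)ᶜ ≤ w j * δ) :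
    μ {ω | ¬ Tendsto (fun n => ∑ j ∈ Finset.range n, w j * (A j).indicator 1 ω) atTop atTop} ≤
      ENNReal.ofReal δ := by
  set B : ℕ → Set Ω := fun K =>
    {ω | ∀ n, ∑ j ∈ Finset.range n, w j * (A j).indicator 1 ω ≤ (K : ℝ)} with hB
  have hmeas : ∀ n, Measurable (fun ω => ∑ j ∈ Finset.range n, w j * (A j).indicator (1 : Ω → ℝ) ω) :=
    fun n => Finset.measurable_fun_sum _ fun j _ =>
      ((measurable_one).indicator (hA j)).const_mul (w j)
  have hBm : ∀ K, MeasurableSet (B K) := by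
    intro K
    have : B K = ⋂ n, {ω | ∑ j ∈ Finset.range n, w j * (A j).indicator 1 ω ≤ (K : ℝ)} := by
      ext ω; simp [hB]
    rw [this]
    exact MeasurableSet.iInter fun n => measurableSet_le (hmeas n) measurable_const
  have hBδ : ∀ K, μ.real (B K) ≤ δ := by
    intro K
    -- On `B K` the events that fail carry weight at least `∑ w - K`, while their expected weight is
    -- at most `δ ∑ w`. Since `∑ w` is unbounded, `μ (B K) ≤ δ`.
    have hbound : ∀ n, (μ.real (B K) - δ) * ∑ j ∈ Finset.range n, w j ≤ K := by
      intro n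
      have hi : ∀ j, Integrable (fun ω => w j * (A j)ᶜ.indicator (1 : Ω → ℝ) ω) μ := fun j =>
        (((integrable_const (1 : ℝ)).indicator (hA j).compl)).const_mul (w j)
      have hnn : ∀ ω, 0 ≤ ∑ j ∈ Finset.range n, w j * (A j)ᶜ.indicator (1 : Ω → ℝ) ω := fun ω =>
        Finset.sum_nonneg fun j _ => mul_nonneg (hw j)
          (Set.indicator_nonneg (fun _ _ => zero_le_one) ω)
      have hle : ∀ ω ∈ B K, (∑ j ∈ Finset.range n, w j) - K ≤
          ∑ j ∈ Finset.range n, w j * (A j)ᶜ.indicator (1 : Ω → ℝ) ω := by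
        intro ω hω
        have h1 := hω n
        have h2 : ∑ j ∈ Finset.range n, w j =
            ∑ j ∈ Finset.range n, w j * (A j).indicator (1 : Ω → ℝ) ω +
            ∑ j ∈ Finset.range n, w j * (A j)ᶜ.indicator (1 : Ω → ℝ) ω := by
          rw [← Finset.sum_add_distrib]
          refine Finset.sum_congr rfl fun j _ => ?_
          by_cases hj : ω ∈ A j <;> simp [hj]
        linarith
      have hint : Integrable
          (fun ω => ∑ j ∈ Finset.range n, w j * (A j)ᶜ.indicator (1 : Ω → ℝ) ω) μ :=
        integrable_finsetSum _ fun j _ => hi j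
      have h3 : ((∑ j ∈ Finset.range n, w j) - K) * μ.real (B K) ≤
          ∑ j ∈ Finset.range n, w j * δ := by
        calc _ = ∫ ω in B K, ((∑ j ∈ Finset.range n, w j) - K) ∂μ := by simp [mul_comm]
          _ ≤ ∫ ω in B K, ∑ j ∈ Finset.range n, w j * (A j)ᶜ.indicator (1 : Ω → ℝ) ω ∂μ :=
            setIntegral_mono_on (integrable_const _).integrableOn hint.integrableOn (hBm K) hle
          _ ≤ ∫ ω, ∑ j ∈ Finset.range n, w j * (A j)ᶜ.indicator (1 : Ω → ℝ) ω ∂μ :=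
            setIntegral_le_integral hint (ae_of_all _ hnn)
          _ = ∑ j ∈ Finset.range n, w j * μ.real (A j)ᶜ := by
            rw [integral_finsetSum _ fun j _ => hi j]
            refine Finset.sum_congr rfl fun j _ => ?_
            rw [integral_const_mul, integral_indicator_one (hA j).compl]
          _ ≤ _ := Finset.sum_le_sum fun j _ => hδ j
      rw [← Finset.sum_mul] at h3
      have h4 : μ.real (B K) ≤ 1 := measureReal_le_one
      have h5 : (K : ℝ) * μ.real (B K) ≤ K := mul_le_of_le_one_right (Nat.cast_nonneg _) h4
      linarith
    by_contra! hlt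
    have ht := hdiv.const_mul_atTop (sub_pos.2 hlt)
    obtain ⟨n, hn⟩ := (ht.eventually (eventually_gt_atTop (K : ℝ))).exists
    exact absurd (hbound n) (not_le.2 hn)
  have hmono : Monotone B := fun K K' hK ω hω n => (hω n).trans (by exact_mod_cast hK)
  calc _ ≤ μ (⋃ K, B K) := by
        refine measure_mono fun ω hω => ?_
        have hm : Monotone (fun n => ∑ j ∈ Finset.range n, w j * (A j).indicator (1 : Ω → ℝ) ω) :=
          monotone_nat_of_le_succ fun n => by
            rw [Finset.sum_range_succ]
            exact le_add_of_nonneg_right (mul_nonneg (hw n)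
              (Set.indicator_nonneg (fun _ _ => zero_le_one) ω))
        by_contra hcon
        refine hω (tendsto_atTop_atTop_of_monotone hm fun b => ?_)
        simp only [Set.mem_iUnion, hB, Set.mem_ofPred_eq, not_exists, not_forall, not_le] at hcon
        obtain ⟨n, hn⟩ := hcon ⌈b⌉₊
        exact ⟨n, (Nat.le_ceil b).trans hn.le⟩
    _ = ⨆ K, μ (B K) := hmono.measure_iUnion
    _ ≤ _ := iSup_le fun K => by
        rw [← ofReal_measureReal]
        exact ENNReal.ofReal_le_ofReal (hBδ K)

lemma tendsto_sum_odd_inv_atTop (c : ℝ) (hc : 0 < c) (j₀ : ℕ) :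
    Tendsto (fun n => ∑ j ∈ Finset.range n, if j₀ ≤ j then c / ((2 * j + 3 : ℕ) : ℝ) else 0)
      atTop atTop := by
  have h := (Real.tendsto_sum_range_one_div_nat_succ_atTop.const_mul_atTop
    (show 0 < c / 3 by positivity))
  have h' := tendsto_atTop_add_const_right atTop (-(∑ j ∈ Finset.range j₀, c / 3 * (1 / ((j : ℝ) + 1)))) h
  refine tendsto_atTop_mono' atTop ?_ h'
  filter_upwards [eventually_ge_atTop j₀] with n hn
  rw [Finset.mul_sum, ← Finset.sum_range_add_sum_Ico _ hn, ← Finset.sum_range_add_sum_Ico _ hn,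
    add_comm (∑ j ∈ Finset.range j₀, _) (∑ j ∈ Finset.Ico j₀ n, c / 3 * _), add_neg_cancel_right]
  refine le_add_of_nonneg_of_le (Finset.sum_nonneg fun j _ => ?_) (Finset.sum_le_sum fun j hj => ?_)
  · split_ifs <;> positivity
  · rw [if_pos (Finset.mem_Ico.1 hj).1, div_mul_div_comm, mul_one]
    gcongr
    push_cast; linarith

/-! ### Recurrence for walks with long blocks -/

lemma monotone_of_le_iff {a N : ℕ → ℕ} (ha : ∀ i, 1 ≤ i → ∀ k, a i ≤ k ↔ i ≤ N k) :
    Monotone N := by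
  intro k k' hk
  rcases Nat.eq_zero_or_pos (N k) with h | h
  · omega
  · exact (ha _ h _).1 (((ha _ h k).2 le_rfl).trans hk)

/-- The walk whose steps are constant on long enough blocks is recurrent. -/
theorem awalkRecurrent_of_blocks {Ω : Type*} [mΩ : MeasurableSpace Ω] {μ : Measure Ω}
    [IsProbabilityMeasure μ] {X : ℕ → Ω → ℝ} (hX : IsRademacherSeq μ X) (a N : ℕ → ℕ)
    (ha : ∀ i, 1 ≤ i → ∀ k, a i ≤ k ↔ i ≤ N k) (M : ℝ) (hM : 0 < M) (k₀ : ℕ)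
    (hratio : ∀ k, k₀ ≤ k → (N k : ℝ) ≤ M * (N (k + 1) - N k : ℕ))
    (hlong : ∀ k, k₀ ≤ k → (k + 1) ^ 4 ≤ N (k + 1) - N k) :
    AWalkRecurrent μ (fun i => (a i : ℝ)) X := by
  have hN : Monotone N := monotone_of_le_iff ha
  have haeq : ∀ k i, N k < i → i ≤ N (k + 1) → a i = k + 1 := by
    intro k i h1 h2
    have h3 := (ha i (by omega) (k + 1)).2 h2
    have h4 := (ha i (by omega) k).not.2 (by omega)
    omega
  set S : ℕ → Ω → ℝ := aWalk (fun i => (a i : ℝ)) X with hS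
  have hSm : ∀ n p, n ≤ p → Measurable[sigmaOf X (Set.Icc 1 p)] (S n) := fun n p hnp =>
    measurable_sum_sigmaOf X _ fun i hi => by
      rw [Finset.mem_Icc] at hi
      exact ⟨⟨hi.1, hi.2.trans hnp⟩, hi.1⟩
  -- `ℱ j` is the past up to the end of block `2j + 1`; a hit in `E (j + 1)` will be forced by the
  -- signs of blocks `2j + 2` and `2j + 3`, which are independent of it.
  let ℱ : Filtration ℕ mΩ :=
    { seq := fun j => sigmaOf X (Set.Icc 1 (N (2 * j + 1)))
      mono' := fun i j hij => sigmaOf_mono X (Set.Icc_subset_Icc_right (hN (by omega)))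
      le' := fun j => hX.sigmaOf_le _ }
  set E : ℕ → Set Ω := fun j => ⋃ n ∈ Finset.Icc (N (2 * j)) (N (2 * j + 1)), {ω | S n ω = 0} with hE
  have hEm : ∀ j, MeasurableSet[ℱ j] (E j) := fun j =>
    Finset.measurableSet_biUnion _ fun n hn =>
      hSm n _ (Finset.mem_Icc.1 hn).2 (measurableSet_singleton 0)
  have hEm' : ∀ j, MeasurableSet (E j) := fun j => ℱ.le j _ (hEm j)
  have hlevy := ae_mem_limsup_atTop_iff (ℱ := ℱ) μ hEm
  have hNtop : Tendsto (fun j => N (2 * j)) atTop atTop := by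
    refine tendsto_atTop_mono' atTop ?_ tendsto_id
    filter_upwards [eventually_ge_atTop (k₀ + 1)] with j hj
    have h1 := hlong (2 * j - 1) (by omega)
    rw [show 2 * j - 1 + 1 = 2 * j by omega] at h1
    have h2 : 2 * j ≤ (2 * j) ^ 4 := Nat.le_self_pow (by norm_num) _
    simp only [id]
    omega
  have hrec : ∀ ω, ω ∈ limsup E atTop → ∃ᶠ n in atTop, S n ω = 0 := by
    intro ω hω
    rw [mem_limsup_iff_frequently_mem] at hω
    rw [frequently_atTop]
    intro n
    obtain ⟨j, hj, hj'⟩ := (hω.and_eventually (hNtop.eventually_ge_atTop n)).exists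
    simp only [hE, Set.mem_iUnion, Finset.mem_Icc] at hj
    obtain ⟨p, hp, hp0⟩ := hj
    exact ⟨p, by omega, hp0⟩
  have hcond_nonneg : ∀ᵐ ω ∂μ, ∀ j, 0 ≤ (μ[(E (j + 1)).indicator (1 : Ω → ℝ) | ℱ j]) ω := by
    rw [ae_all_iff]
    exact fun j => condExp_nonneg (ae_of_all _ fun ω =>
      Set.indicator_nonneg (fun _ _ => zero_le_one) ω)
  have main : ∀ C : ℝ, 0 < C → μ {ω | ¬ ∃ᶠ n in atTop, S n ω = 0} ≤ ENNReal.ofReal (M / C ^ 2) := by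
    intro C hC
    obtain ⟨c, hc, n₀, hit⟩ := IsRademacherSeq.exists_hit_lower μ C M hC hM
    set j₀ := k₀ + n₀ with hj₀
    set t : ℕ → ℝ := fun j =>
      C * (2 * j + 3 : ℕ) * √(N (2 * j + 3) - N (2 * j + 2) : ℕ) with ht
    set A : ℕ → Set Ω := fun j => {ω | |S (N (2 * j + 1)) ω| < t j} with hA
    have hSm' : ∀ j, Measurable (S (N (2 * j + 1))) := fun j =>
      (hSm _ _ le_rfl).mono (hX.sigmaOf_le _) le_rfl
    have hAm : ∀ j, MeasurableSet (A j) := fun j =>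
      measurableSet_lt (hSm' j).abs measurable_const
    have hlow : ∀ᵐ ω ∂μ, ∀ j, j₀ ≤ j → ω ∈ A j →
        c / ((2 * j + 3 : ℕ) : ℝ) ≤ (μ[(E (j + 1)).indicator (1 : Ω → ℝ) | ℱ j]) ω := by
      rw [ae_all_iff]
      intro j
      by_cases hj : j₀ ≤ j
      swap
      · simp [hj]
      -- The walk is a.s. integer-valued, so countably many values `s` can be treated one at a time,
      -- each with its own `F`.
      have hs : ∀ᵐ ω ∂μ, ∀ s : ℤ, |(s : ℝ)| ≤ t j → S (N (2 * j + 1)) ω = s →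
          c / ((2 * j + 3 : ℕ) : ℝ) ≤ (μ[(E (j + 1)).indicator (1 : Ω → ℝ) | ℱ j]) ω := by
        rw [ae_all_iff]
        intro s
        by_cases hst : |(s : ℝ)| ≤ t j
        swap
        · simp [hst]
        have l1 : (2 * j + 1 + 1) ^ 4 ≤ N (2 * j + 2) - N (2 * j + 1) :=
          hlong (2 * j + 1) (by omega)
        have l2 : (2 * j + 2 + 1) ^ 4 ≤ N (2 * j + 3) - N (2 * j + 2) :=
          hlong (2 * j + 2) (by omega)
        have m1 := hN (show 2 * j + 1 ≤ 2 * j + 2 by omega)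
        have m2 := hN (show 2 * j + 2 ≤ 2 * j + 3 by omega)
        have q1 : n₀ ≤ (2 * j + 1 + 1) ^ 4 :=
          le_trans (by omega) (Nat.le_self_pow (by norm_num) (2 * j + 1 + 1))
        have q2 : n₀ ≤ (2 * j + 2 + 1) ^ 4 :=
          le_trans (by omega) (Nat.le_self_pow (by norm_num) (2 * j + 2 + 1))
        -- Fourth-power length leaves room for `k ^ 2` steps in block `k - 1`, where `k = 2j + 3`.
        have q3 : (2 * j + 3) ^ 2 ≤ (2 * j + 1 + 1) ^ 4 := by
          rw [show (2 * j + 1 + 1) ^ 4 = ((2 * j + 1 + 1) ^ 2) ^ 2 by ring]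
          gcongr
          nlinarith
        obtain ⟨F, hF, hcF, hFit⟩ := hit X hX (N (2 * j + 1)) (N (2 * j + 2)) (N (2 * j + 3))
          (2 * j + 3) (by omega) (by omega) ⟨j + 1, by ring⟩ (by omega)
          (le_trans (by exact_mod_cast Nat.sub_le _ _) (hratio (2 * j + 2) (by omega))) s hst
        have hind : Indep (sigmaOf X (Set.Ioc (N (2 * j + 1)) (N (2 * j + 3)))) (ℱ j) μ := by
          refine hX.indep_sigmaOf ?_
          rw [Set.disjoint_left]
          intro i h1 h2
          rw [Set.mem_Ioc] at h1
          rw [Set.mem_Icc] at h2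
          omega
        have := le_condExp_indicator_of_indep (ℱ.le j) (hX.sigmaOf_le _) hind (hEm' (j + 1)) hF
          (hSm (N (2 * j + 1)) _ le_rfl) (s : ℝ) (by
            filter_upwards [hX.ae_eq_or] with ω hω hωF hωS
            obtain ⟨n, h1, h2, h3⟩ := hFit (fun i => (a i : ℝ))
              (fun i h1 h2 => by rw [haeq (2 * j + 1) i h1 h2]; push_cast; ring)
              (fun i h1 h2 => by rw [haeq (2 * j + 2) i h1 h2]) ω hωF hω hωS
            exact Set.mem_iUnion₂.2 ⟨n, Finset.mem_Icc.2 ⟨h1, h2⟩, h3⟩)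
        filter_upwards [this] with ω hω _ hωS
        exact hcF.trans (hω hωS)
      filter_upwards [hs, hX.ae_eq_or] with ω hω hωX _ hωA
      obtain ⟨s, hs⟩ : ∃ s : ℤ, S (N (2 * j + 1)) ω = s := by
        have : ∀ n, ∃ s : ℤ, S n ω = s := by
          intro n
          induction n with
          | zero => exact ⟨0, by simp [hS, aWalk]⟩
          | succ n ih =>
            obtain ⟨s, hs⟩ := ih
            simp only [hS] at hs ⊢
            rw [aWalk_succ, hs]
            rcases hωX (n + 1) (by omega) with h | h
            · exact ⟨s + a (n + 1), by rw [h]; push_cast; ring⟩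
            · exact ⟨s - a (n + 1), by rw [h]; push_cast; ring⟩
        exact this _
      refine hω s ?_ hs
      rw [← hs]
      exact le_of_lt hωA
    set w : ℕ → ℝ := fun j => if j₀ ≤ j then c / ((2 * j + 3 : ℕ) : ℝ) else 0 with hw
    have hw0 : ∀ j, 0 ≤ w j := fun j => by simp only [hw]; split_ifs <;> positivity
    have hbad := measure_not_tendsto_weighted_sum_le (μ := μ) hw0
      (tendsto_sum_odd_inv_atTop c hc j₀) hAm (δ := M / C ^ 2) (by
        intro j
        by_cases hj : j₀ ≤ j
        swap
        -- Small `j` carry weight zero, so nothing is asked of `A j` there.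
        · simp [hw, hj]
        refine mul_le_mul_of_nonneg_left ?_ (hw0 j)
        have hcompl : (A j)ᶜ = {ω | t j ≤ |aWalk (fun i => (a i : ℝ)) X (N (2 * j + 1)) ω|} := by
          ext ω; simp [hA, hS]
        have l2 := hlong (2 * j + 2) (by omega)
        have hpos : 0 < N (2 * j + 3) - N (2 * j + 2) := lt_of_lt_of_le (by positivity) l2
        have hposr : (0 : ℝ) < (N (2 * j + 3) - N (2 * j + 2) : ℕ) := by exact_mod_cast hpos
        have hk : (0 : ℝ) < (2 * j + 3 : ℕ) := by positivity
        have htpos : 0 < t j := by simp only [ht]; positivity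
        rw [hcompl]
        -- All weights so far are at most `k = 2j + 3`, so `k ^ 2` cancels between the variance
        -- bound and `t j ^ 2`.
        refine (hX.measureReal_abs_sum_ge_le _ _ (b := (2 * j + 3 : ℕ)) ?_ htpos).trans ?_
        · intro i h1 h2
          rw [abs_of_nonneg (Nat.cast_nonneg _)]
          have := (ha i h1 _).2 h2
          exact_mod_cast this.trans (by omega)
        · have hr := hratio (2 * j + 2) (by omega)
          have hmon : (N (2 * j + 1) : ℝ) ≤ N (2 * j + 2) := by
            exact_mod_cast hN (show 2 * j + 1 ≤ 2 * j + 2 by omega)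
          simp only [ht]
          rw [mul_pow, mul_pow, Real.sq_sqrt hposr.le, div_le_div_iff₀ (by positivity) (by positivity)]
          calc _ ≤ ((2 * j + 3 : ℕ) : ℝ) ^ 2 * (M * (N (2 * j + 3) - N (2 * j + 2) : ℕ)) * C ^ 2 := by
                gcongr; exact hmon.trans hr
            _ = _ := by ring)
    refine le_trans (measure_mono_ae ?_) hbad
    filter_upwards [hlevy, hcond_nonneg, hlow] with ω h1 h2 h3 h4 h5
    refine h4 (hrec ω (h1.2 (tendsto_atTop_mono (fun n => ?_) h5)))
    refine Finset.sum_le_sum fun j _ => ?_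
    by_cases hj : j₀ ≤ j
    swap
    · simp only [hw, if_neg hj, zero_mul]; exact h2 j
    by_cases hωA : ω ∈ A j
    · simp only [hw, if_pos hj, Set.indicator_of_mem hωA, Pi.one_apply, mul_one]
      exact h3 j hj hωA
    · simp only [Set.indicator_of_notMem hωA, mul_zero]; exact h2 j
  have hlim : Tendsto (fun C : ℝ => ENNReal.ofReal (M / C ^ 2)) atTop (nhds 0) := by
    rw [← ENNReal.ofReal_zero]
    exact (ENNReal.continuous_ofReal.tendsto 0).comp
      ((tendsto_const_nhds).div_atTop (tendsto_pow_atTop (by norm_num)))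
  have hzero : μ {ω | ¬ ∃ᶠ n in atTop, S n ω = 0} ≤ 0 :=
    ge_of_tendsto hlim ((eventually_gt_atTop 0).mono fun C hC => main C hC)
  exact le_antisymm hzero bot_le

/-! ### From the growth condition to block ratios -/

/-- The term `N 0` accounts for an initial block of zeros, which both logarithmic sequences have. -/
lemma eq_add_sum_of_blockLengths {N L : ℕ → ℕ} (hN : Monotone N)
    (hL : ∀ k, L (k + 1) = N (k + 1) - N k) (k : ℕ) :
    N k = N 0 + ∑ j ∈ Finset.Icc 1 k, L j := by
  induction k with
  | zero => simp
  | succ k ih =>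
    rw [Finset.sum_Icc_succ_top (by omega), ← add_assoc, ← ih, hL]
    have : N k ≤ N (k + 1) := hN (Nat.le_succ k)
    omega

lemma blockLength_succ_of_le_iff {a N : ℕ → ℕ} (ha : ∀ i, 1 ≤ i → ∀ k, a i ≤ k ↔ i ≤ N k)
    (k : ℕ) : blockLength a (k + 1) = N (k + 1) - N k := by
  have : {i : ℕ | 1 ≤ i ∧ a i = k + 1} = Finset.Ioc (N k) (N (k + 1)) := by
    ext i
    simp only [Set.mem_ofPred_eq, Finset.coe_Ioc, Set.mem_Ioc]
    constructor
    · rintro ⟨h1, h2⟩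
      exact ⟨not_le.1 ((ha i h1 k).not.1 (by omega)), (ha i h1 (k + 1)).1 h2.le⟩
    · rintro ⟨h1, h2⟩
      have h3 := (ha i (by omega) (k + 1)).2 h2
      have h4 := (ha i (by omega) k).not.2 (by omega)
      omega
  rw [blockLength, this, Set.ncard_coe_finset, Nat.card_Ioc]

theorem awalkRecurrent_of_blockGrowth {Ω : Type*} [MeasurableSpace Ω] {μ : Measure Ω}
    [IsProbabilityMeasure μ] {X : ℕ → Ω → ℝ} (hX : IsRademacherSeq μ X) {a N L : ℕ → ℕ}
    (ha : ∀ i, 1 ≤ i → ∀ k, a i ≤ k ↔ i ≤ N k) (hL : ∀ k, L (k + 1) = N (k + 1) - N k)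
    (hg : BlockGrowth L) : AWalkRecurrent μ (fun i => (a i : ℝ)) X := by
  obtain ⟨ε, hε, r, hr, k₀, h⟩ := hg
  have hN := monotone_of_le_iff ha
  set k₁ := max k₀ 1 with hk₁
  have hev : ∀ᶠ k : ℕ in atTop, 2 ≤ Real.log k :=
    (Real.tendsto_log_atTop.comp tendsto_natCast_atTop_atTop).eventually_ge_atTop 2
  obtain ⟨k₂, hk₂⟩ := eventually_atTop.1 hev
  -- Freeze `k' = k₁`: once `log k ≥ 2` and `k ≥ 2k₁`, one has `k - k₁ ≥ k/2 ≥ k / log k`.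
  have key : ∀ k, 2 * k₁ + k₂ ≤ k → (L (k + 1) : ℝ) ≥ ∑ j ∈ Finset.Icc 1 k₁, (L j : ℝ) ∧
      (L (k + 1) : ℝ) ≥ 2 * r * ∑ j ∈ Finset.Ioo k₁ (k + 1), (L j : ℝ) ∧
      (k + 1) ^ 4 ≤ L (k + 1) := by
    intro k hk
    have h1 : 1 ≤ k₁ := le_max_right _ _
    have h0 : k₀ ≤ k₁ := le_max_left _ _
    have hlog := hk₂ (k + 1) (by omega)
    have hkr : 2 * (k₁ : ℝ) ≤ (k + 1 : ℕ) := by exact_mod_cast (by omega : 2 * k₁ ≤ k + 1)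
    obtain ⟨e1, e2, e3⟩ := h (k + 1) k₁ (by omega) h1 (by omega) h0 (by
      have : ((k + 1 : ℕ) : ℝ) / Real.log (k + 1 : ℕ) ≤ (k + 1 : ℕ) / 2 := by gcongr
      linarith)
    refine ⟨le_trans ?_ e1, e2, by exact_mod_cast e3⟩
    refine le_mul_of_one_le_left (Finset.sum_nonneg fun _ _ => Nat.cast_nonneg _) ?_
    nlinarith
  -- The three terms of the ratio bound the zeros, the first `k₁` blocks and the remaining blocks,
  -- each against `L (k + 1)`.
  refine awalkRecurrent_of_blocks hX a N ha (N 0 + 1 + 1 / (2 * r)) (by positivity)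
    (2 * k₁ + k₂) (fun k hk => ?_) (fun k hk => ?_)
  · obtain ⟨e1, e2, e3⟩ := key k hk
    rw [← hL]
    have hL1 : (1 : ℝ) ≤ L (k + 1) := by
      exact_mod_cast (Nat.one_le_pow 4 (k + 1) (by omega)).trans e3
    have hsum : ((N k : ℕ) : ℝ) = N 0 + (∑ j ∈ Finset.Icc 1 k₁, (L j : ℝ) +
        ∑ j ∈ Finset.Ioo k₁ (k + 1), (L j : ℝ)) := by
      rw [eq_add_sum_of_blockLengths hN hL k, ← Finset.sum_union]
      · push_cast
        congr 2
        ext j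
        simp only [Finset.mem_union, Finset.mem_Icc, Finset.mem_Ioo]
        omega
      · rw [Finset.disjoint_left]
        intro j h1 h2
        rw [Finset.mem_Icc] at h1
        rw [Finset.mem_Ioo] at h2
        omega
    rw [hsum]
    have h2 : ∑ j ∈ Finset.Ioo k₁ (k + 1), (L j : ℝ) ≤ 1 / (2 * r) * L (k + 1) := by
      rw [div_mul_eq_mul_div, one_mul, le_div_iff₀ (by positivity)]
      linarith
    have h3 : (N 0 : ℝ) ≤ N 0 * L (k + 1) := le_mul_of_one_le_right (Nat.cast_nonneg _) hL1
    linarith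
  · rw [← hL]; exact (key k hk).2.2

/-! ### The growth condition from geometric growth -/

/-- A fixed proportion of `G k` lies in block `k`, while the blocks up to `k'` total at most `G k' ≤
γ^(-(k-k')) G k`. With `y = k / log k`, the gain `γ^(y-2)` eventually beats `3y ≥ 3 log k`, so `ε =
1` works. -/
lemma blockGrowth_of_geometric {γ : ℝ} (hγ : 1 < γ) {N L : ℕ → ℕ} {G : ℕ → ℝ} (hN : Monotone N)
    (hL : ∀ k, L (k + 1) = N (k + 1) - N k) (hlow : ∀ k, G k - 1 ≤ N k)
    (hup : ∀ k, (N k : ℝ) ≤ G k) (hG0 : 1 ≤ G 0) (hG : ∀ k, γ * G k ≤ G (k + 1)) :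
    BlockGrowth L := by
  have hγ0 : 0 < γ := by linarith
  have hGpow : ∀ k d, γ ^ d * G k ≤ G (k + d) := by
    intro k d
    induction d with
    | zero => simp
    | succ d ih =>
      calc γ ^ (d + 1) * G k = γ * (γ ^ d * G k) := by ring
        _ ≤ γ * G (k + d) := by gcongr
        _ ≤ _ := hG _
  have hGge : ∀ k, γ ^ k ≤ G k := fun k => by
    have := hGpow 0 k
    rw [zero_add] at this
    refine le_trans ?_ this
    exact le_mul_of_one_le_right (by positivity) hG0
  have hGpos : ∀ k, 0 < G k := fun k => lt_of_lt_of_le (by positivity) (hGge k)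
  -- Half of the proportion `1 - 1/γ`; the other half absorbs the rounding error `-1` in `hLr`.
  set θ : ℝ := (1 - 1 / γ) / 2 with hθ
  have hθ0 : 0 < θ := by
    have : 1 / γ < 1 := by rw [div_lt_one hγ0]; exact hγ
    simp only [hθ]; linarith
  have hsumN : ∀ k, ∑ j ∈ Finset.Icc 1 k, (L j : ℝ) ≤ G k := by
    intro k
    refine le_trans ?_ (hup k)
    rw [eq_add_sum_of_blockLengths hN hL k]
    push_cast
    linarith [Nat.cast_nonneg (α := ℝ) (N 0)]
  have hLr : ∀ k, (L (k + 1) : ℝ) ≥ 2 * θ * G (k + 1) - 1 := by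
    intro k
    rw [hL, Nat.cast_sub (hN (Nat.le_succ k))]
    have h1 := hlow (k + 1)
    have h2 := hup k
    have h3 : G k ≤ G (k + 1) / γ := by rw [le_div_iff₀ hγ0]; linarith [hG k]
    have h4 : 2 * θ * G (k + 1) = G (k + 1) - G (k + 1) / γ := by simp only [hθ]; ring
    linarith
  have hpow : Tendsto (fun k : ℕ => γ ^ k) atTop atTop := tendsto_pow_atTop_atTop_of_one_lt hγ
  have hy : Tendsto (fun k : ℕ => (k : ℝ) / Real.log k) atTop atTop := by
    have h1 : Tendsto (fun x : ℝ => x / Real.log x) atTop atTop := by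
      have h2 : Tendsto (fun x : ℝ => Real.log x / x) atTop (nhds 0) := by
        simpa using Real.isLittleO_log_id_atTop.tendsto_div_nhds_zero
      have h3 : Tendsto (fun x : ℝ => Real.log x / x) atTop (nhdsWithin 0 (Set.Ioi 0)) := by
        refine tendsto_nhdsWithin_iff.2 ⟨h2, ?_⟩
        filter_upwards [eventually_gt_atTop 1] with x hx
        exact div_pos (Real.log_pos hx) (by linarith)
      exact h3.inv_tendsto_nhdsGT_zero.congr fun x => by simp
    exact h1.comp tendsto_natCast_atTop_atTop
  have ev1 : ∀ᶠ k : ℕ in atTop, 1 ≤ θ * G k := by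
    have := (hpow.const_mul_atTop hθ0).eventually_ge_atTop 1
    filter_upwards [this] with k hk
    exact hk.trans (by gcongr; exact hGge k)
  have ev2 : ∀ᶠ k : ℕ in atTop, (k : ℝ) ^ 4 ≤ θ * G k := by
    have h1 := (tendsto_pow_const_div_const_pow_of_one_lt 4 hγ).eventually_le_const hθ0
    filter_upwards [h1] with k hk
    rw [div_le_iff₀ (by positivity)] at hk
    exact hk.trans (by gcongr; exact hGge k)
  have ev3 : ∀ᶠ k : ℕ in atTop, Real.log k ≤ (k : ℝ) / Real.log k := by
    have h1 : ∀ᶠ x : ℝ in atTop, ‖Real.log x ^ 2‖ ≤ 1 * ‖x‖ := by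
      have := (Real.isLittleO_pow_log_id_atTop (n := 2)).bound one_pos
      simpa using this
    filter_upwards [tendsto_natCast_atTop_atTop.eventually h1, eventually_gt_atTop 1] with k hk hk1
    have hlog : 0 < Real.log k := Real.log_pos (by exact_mod_cast hk1)
    rw [le_div_iff₀ hlog]
    rw [Real.norm_of_nonneg (by positivity), Real.norm_of_nonneg (by positivity)] at hk
    nlinarith
  have ev4 : ∀ᶠ k : ℕ in atTop,
      3 * ((k : ℝ) / Real.log k) ≤ θ * γ ^ ((k : ℝ) / Real.log k - 2) := by
    have h1 : ∀ᶠ y : ℝ in atTop, 3 * y ≤ θ * γ ^ (y - 2) := by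
      have hlogγ : 0 < Real.log γ := Real.log_pos hγ
      have h2 : Tendsto (fun y : ℝ => y ^ (1 : ℝ) * Real.exp (-Real.log γ * y)) atTop (nhds 0) :=
        tendsto_rpow_mul_exp_neg_mul_atTop_nhds_zero 1 _ hlogγ
      have h3 := h2.eventually_le_const (show 0 < θ / (3 * γ ^ (2 : ℝ)) by positivity)
      filter_upwards [h3] with y hy
      rw [Real.rpow_sub hγ0, mul_div_assoc', le_div_iff₀ (by positivity)]
      rw [Real.rpow_one, le_div_iff₀ (by positivity)] at hy
      have h4 : γ ^ y * Real.exp (-Real.log γ * y) = 1 := by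
        rw [Real.rpow_def_of_pos hγ0, ← Real.exp_add]; simp
      have h5 : 0 < γ ^ y := by positivity
      calc 3 * y * γ ^ (2 : ℝ) = (y * Real.exp (-Real.log γ * y) * (3 * γ ^ (2 : ℝ))) * γ ^ y := by
            linear_combination (-(3 * y * γ ^ (2 : ℝ))) * h4
        _ ≤ _ := by gcongr
    exact hy.eventually h1
  -- Makes `k / log k - 2` non-negative, so that the gap condition implies `k' ≤ k`.
  have ev5 := hy.eventually_ge_atTop 2
  obtain ⟨k₀, hk₀⟩ := eventually_atTop.1 (ev1.and (ev2.and (ev3.and (ev4.and ev5))))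
  refine ⟨1, one_pos, θ / 2, by positivity, k₀, fun k k' hk2 hk1' hk hk' hkk' => ?_⟩
  obtain ⟨e1, e2, e3, e4, e5⟩ := hk₀ k hk
  have hLk : θ * G k ≤ L k := by
    obtain ⟨l, rfl⟩ : ∃ l, k = l + 1 := ⟨k - 1, by omega⟩
    linarith [hLr l]
  refine ⟨?_, ?_, e2.trans hLk⟩
  · have hle : k' ≤ k := by
      have : (k' : ℝ) ≤ k := by linarith
      exact_mod_cast this
    have hGk := hGpow k' (k - k')
    rw [Nat.add_sub_cancel' hle] at hGk
    have hpowle : γ ^ ((k : ℝ) / Real.log k - 2) ≤ γ ^ (k - k') := by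
      rw [← Real.rpow_natCast γ (k - k'), Nat.cast_sub hle]
      exact Real.rpow_le_rpow_of_exponent_le hγ.le hkk'
    have hlog : 0 ≤ Real.log k := Real.log_natCast_nonneg k
    calc (2 + 1) * Real.log k * ∑ j ∈ Finset.Icc 1 k', (L j : ℝ)
        ≤ (2 + 1) * Real.log k * G k' := by gcongr; exact hsumN k'
      _ ≤ (θ * γ ^ (k - k')) * G k' := by
        have h1 : (2 + 1) * Real.log k ≤ θ * γ ^ (k - k') := by
          calc (2 + 1) * Real.log k ≤ 3 * ((k : ℝ) / Real.log k) := by linarith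
            _ ≤ _ := e4
            _ ≤ _ := by gcongr
        exact mul_le_mul_of_nonneg_right h1 (hGpos k').le
      _ = θ * (γ ^ (k - k') * G k') := by ring
      _ ≤ θ * G k := by gcongr
      _ ≤ _ := hLk
  · have h1 : ∑ j ∈ Finset.Ioo k' k, (L j : ℝ) ≤ ∑ j ∈ Finset.Icc 1 (k - 1), (L j : ℝ) := by
      refine Finset.sum_le_sum_of_subset_of_nonneg (fun j hj => ?_) fun _ _ _ => Nat.cast_nonneg _
      rw [Finset.mem_Ioo] at hj
      rw [Finset.mem_Icc]
      omega
    have h2 : G (k - 1) ≤ G k := by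
      obtain ⟨l, rfl⟩ : ∃ l, k = l + 1 := ⟨k - 1, by omega⟩
      have := hG l
      have := hGpos l
      rw [Nat.add_sub_cancel]
      nlinarith
    calc 2 * (θ / 2) * ∑ j ∈ Finset.Ioo k' k, (L j : ℝ) = θ * ∑ j ∈ Finset.Ioo k' k, (L j : ℝ) := by
          ring
      _ ≤ θ * G k := by gcongr; exact h1.trans ((hsumN _).trans h2)
      _ ≤ _ := hLk

/-! ### The block sequence and the logarithmic sequences -/

lemma blockSeq_le_iff {L : ℕ → ℕ} (hL : ∀ k, 1 ≤ k → 1 ≤ L k) (i k : ℕ) :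
    blockSeq L i ≤ k ↔ i ≤ ∑ j ∈ Finset.Icc 1 k, L j := by
  constructor
  · intro h
    -- Positivity of the `L k` excludes the default value `sInf ∅ = 0`.
    have hne : {k : ℕ | i ≤ ∑ j ∈ Finset.Icc 1 k, L j}.Nonempty := by
      refine ⟨i, ?_⟩
      calc i = ∑ j ∈ Finset.Icc 1 i, 1 := by simp
        _ ≤ _ := Finset.sum_le_sum fun j hj => hL j (Finset.mem_Icc.1 hj).1
    exact (Nat.sInf_mem hne).trans
      (Finset.sum_le_sum_of_subset (Finset.Icc_subset_Icc_right h))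
  · intro h
    exact Nat.sInf_le h

/-- A floor is at most `k` when its argument is strictly below `k + 1`; the strictness is why the
last index is a ceiling minus one. -/
lemma floorLogSeq_le_iff {γ β : ℝ} (hγ : 1 < γ) (hβ : 0 < β) (i : ℕ) (hi : 1 ≤ i) (k : ℕ) :
    floorLogSeq γ β i ≤ k ↔ i ≤ ⌈γ ^ (((k : ℝ) + 1) ^ β⁻¹)⌉₊ - 1 := by
  have hγ0 : 0 < γ := by linarith
  have hi' : (1 : ℝ) ≤ i := by exact_mod_cast hi
  have hlog : 0 ≤ Real.logb γ i := Real.logb_nonneg hγ hi'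
  have hce : 1 ≤ ⌈γ ^ (((k : ℝ) + 1) ^ β⁻¹)⌉₊ := Nat.one_le_ceil_iff.2 (by positivity)
  rw [floorLogSeq, ← Nat.lt_succ_iff, Nat.floor_lt (by positivity), Nat.le_sub_one_iff_lt hce,
    Nat.lt_ceil, ← Real.logb_lt_iff_lt_rpow hγ (by linarith),
    Real.lt_rpow_inv_iff_of_pos hlog (by positivity) hβ]
  simp

lemma ceilLogSeq_le_iff {γ : ℝ} (hγ : 1 < γ) (i : ℕ) (hi : 1 ≤ i) (k : ℕ) :
    ceilLogSeq γ i ≤ k ↔ i ≤ ⌊γ ^ k⌋₊ := by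
  have hγ0 : 0 < γ := by linarith
  have hi' : (0 : ℝ) < i := by exact_mod_cast hi
  rw [ceilLogSeq, Nat.ceil_le, Real.logb_le_iff_le_rpow hγ hi', Real.rpow_natCast,
    Nat.le_floor_iff (by positivity)]

lemma blockGrowth_floorLogSeq {γ β : ℝ} (hγ : 1 < γ) (hβ : 0 < β) (hβ1 : β ≤ 1) :
    BlockGrowth (blockLength (floorLogSeq γ β)) := by
  have hγ0 : 0 < γ := by linarith
  have hp : 1 ≤ β⁻¹ := (one_le_inv₀ hβ).2 hβ1
  have ha := floorLogSeq_le_iff hγ hβ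
  have hce : ∀ k : ℕ, 1 ≤ ⌈γ ^ (((k : ℝ) + 1) ^ β⁻¹)⌉₊ := fun k =>
    Nat.one_le_ceil_iff.2 (by positivity)
  refine blockGrowth_of_geometric hγ (G := fun k => γ ^ (((k : ℝ) + 1) ^ β⁻¹))
    (monotone_of_le_iff ha) (blockLength_succ_of_le_iff ha) (fun k => ?_) (fun k => ?_) ?_
    (fun k => ?_)
  · rw [Nat.cast_sub (hce k), Nat.cast_one]
    linarith [Nat.le_ceil (γ ^ (((k : ℝ) + 1) ^ β⁻¹))]
  · rw [Nat.cast_sub (hce k), Nat.cast_one]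
    linarith [Nat.ceil_lt_add_one (show 0 ≤ γ ^ (((k : ℝ) + 1) ^ β⁻¹) by positivity)]
  · simpa using hγ.le
  -- Since `1/β ≥ 1`, the power is superadditive, so the exponent of `γ` grows by at least one per
  -- block.
  · have h : ((k : ℝ) + 1) ^ β⁻¹ + 1 ≤ (((k + 1 : ℕ) : ℝ) + 1) ^ β⁻¹ := by
      have := Real.add_rpow_le_rpow_add (show 0 ≤ (k : ℝ) + 1 by positivity) zero_le_one hp
      rw [Real.one_rpow] at this
      push_cast
      exact this
    calc γ * γ ^ (((k : ℝ) + 1) ^ β⁻¹) = γ ^ (((k : ℝ) + 1) ^ β⁻¹ + 1) := by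
          rw [Real.rpow_add hγ0, Real.rpow_one, mul_comm]
      _ ≤ _ := Real.rpow_le_rpow_of_exponent_le hγ.le h

lemma blockGrowth_ceilLogSeq {γ : ℝ} (hγ : 1 < γ) : BlockGrowth (blockLength (ceilLogSeq γ)) := by
  have ha := ceilLogSeq_le_iff hγ
  refine blockGrowth_of_geometric hγ (G := fun k => γ ^ k) (monotone_of_le_iff ha)
    (blockLength_succ_of_le_iff ha) (fun k => (Nat.sub_one_lt_floor _).le)
    (fun k => Nat.floor_le (pow_nonneg (by linarith) k)) (by simp) (fun k => ?_)
  rw [pow_succ, mul_comm]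

theorem mainTheorem6 {Ω : Type*} [MeasurableSpace Ω] (μ : Measure Ω) [IsProbabilityMeasure μ]
    (X : ℕ → Ω → ℝ) (hX : IsRademacherSeq μ X) :
    (∀ L : ℕ → ℕ, (∀ k, 1 ≤ k → 1 ≤ L k) → BlockGrowth L →
      AWalkRecurrent μ (fun i => (blockSeq L i : ℝ)) X) ∧
    (∀ γ β : ℝ, 1 < γ → 0 < β → β ≤ 1 →
      BlockGrowth (blockLength (floorLogSeq γ β)) ∧
      AWalkRecurrent μ (fun i => (floorLogSeq γ β i : ℝ)) X) ∧
    (∀ γ : ℝ, 1 < γ →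
      BlockGrowth (blockLength (ceilLogSeq γ)) ∧
      AWalkRecurrent μ (fun i => (ceilLogSeq γ i : ℝ)) X) := by
  refine ⟨fun L hL hg => ?_, fun γ β hγ hβ hβ1 => ?_, fun γ hγ => ?_⟩
  · refine awalkRecurrent_of_blockGrowth hX (fun i _ k => blockSeq_le_iff hL i k) (fun k => ?_) hg
    rw [Finset.sum_Icc_succ_top (by omega), Nat.add_sub_cancel_left]
  · have hg := blockGrowth_floorLogSeq hγ hβ hβ1
    have ha := floorLogSeq_le_iff hγ hβ
    exact ⟨hg, awalkRecurrent_of_blockGrowth hX ha (blockLength_succ_of_le_iff ha) hg⟩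
  · have hg := blockGrowth_ceilLogSeq hγ
    have ha := ceilLogSeq_le_iff hγ
    exact ⟨hg, awalkRecurrent_of_blockGrowth hX ha (blockLength_succ_of_le_iff ha) hg⟩
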